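/- **Setting.** Fix $K\ge 1$ arms, $M\in\mathbb R$, a level $\alpha\in(0,1)$, a confidence parameter $\delta\in(0,1)$ and a constant $m=m(\alpha)$. Arm $k$ has cost law $\nu_k$ with distribution function $F_k$ and quantile function $F_k^{-1}(\tau)=\inf\{x: F_k(x)\ge\tau\}$. Assume that $\nu_k([0,M])=1$, that $F_k$ is continuous, and continuously differentiable on $(0,M)$ with density $f_k=F_k'$, and that $f_k(F_k^{-1}(\alpha))>0$ and $1/f_k(F_k^{-1}(\alpha))\le m$ for all $k$. The CVaR of arm $k$ is $\rho_k^C=(1-\alpha)^{-1}\int_\alpha^1F_k^{-1}(\tau)\,d\tau$; the arm $k^*$ of least CVaR is assumed unique, and $\Delta_k^C=\rho_k^C-\rho_{k^*}^C$. Let $X_{k,t}$ be the cost of arm $k$ if pulled at time $t=1,2,\dots$; $X_{k,t}$ has law $\nu_k$, and the costs $(X_{k,t+1})_{k}$ at time $t+1$ are independent of the information available up to time $t$. For observations $y_t$, $t\in S$, with empirical distribution function $\widehat F$ and $q=\widehat F^{-1}(\alpha)$, the empirical CVaR is $q+(1-\alpha)^{-1}\frac1{|S|}\sum_{t\in S}(y_t-q)_+$.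 The RA-LCB policy $\varphi$ makes non-anticipating choices $I_t$: it pulls each arm once in the first $K$ pulls and, for every $n\ge K$, pulls at time $n+1$ an arm minimizing $$B_{k,n}=\widehat\rho_{k,n}-\Big[(1-\alpha)^{-1}\big(1-\tfrac{3\delta}{n}\big)M+2\big(1+(1-\alpha)^{-1}\big)m\Big]\sqrt{\frac{\log(2n^2K/\delta)}{2T_k(n)}},$$ where $T_k(n)$ is the number of pulls of arm $k$ up to time $n$ and $\widehat\rho_{k,n}$ is the empirical CVaR of the costs observed from arm $k$ up to time $n$. Let $\widehat\rho_{\varphi,n}$ be the empirical CVaR of the whole observation sequence $X_{I_1,1},\dots,X_{I_n,n}$, and let the pseudo regret be $R_n^C(\varphi)=\mathbf E\,\widehat\rho_{\varphi,n}-\rho_{k^*}^C$. **Theorem.** There is a constant $C\ge0$, depending only on $K,M,\alpha,\delta,m$ and the gaps $(\Delta_k^C)_k$, such that the following holds. Put $$M_\varphi(n)=\max\{\alpha,1-\alpha\}\,C\,\frac{\log n}{n}\,m+2m\sqrt{\frac{\log(4n/\delta)}{2n}},$$ $$M_k(n)=2\log\frac{2n^2K}{\delta}\left(\frac{2[1+(1-\alpha)^{-1}]m+(1-\alpha)^{-1}M}{\Delta_k^C-(1-\alpha)^{-1}\frac{4\delta}{n^2K}M}\right)^2+3\delta$$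 (with the fraction read as $0$ if its denominator vanishes). Then for all $n>K$ the random variable $\widehat\rho_{\varphi,n}$ is integrable and, provided $n\ge4\delta$ (which is automatic for $n\ge4$), for every arm $j\in\{1,\dots,K\}$, $$R_n^C(\varphi)\le\Big(1-\frac{4\delta}{n}\Big)\Big[M_\varphi(n)+(1-\alpha)^{-1}\frac1n\sum_{k\ne k^*}M_k(n)(M+\Delta_k^C)\Big]+\frac{4\delta}{n}\Big[\big((1-\alpha)^{-1}+1\big)M+(1-\alpha)^{-1}\Delta_j^C\Big].$$ Moreover, as $n\to\infty$, the right-hand side is asymptotically equivalent to $M_\varphi(n)$, and $M_\varphi(n)=O(\sqrt{\log n/n})$; so the upper bound is $O(\sqrt{\log n/n})$. -/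

import Mathlib

open MeasureTheory ProbabilityTheory Asymptotics

namespace RiskBandit

noncomputable section

/-- The `τ`-quantile `F⁻¹(τ) = inf {x : F x ≥ τ}` of a distribution function `F`. -/
def quantile (F : ℝ → ℝ) (τ : ℝ) : ℝ := sInf {x : ℝ | τ ≤ F x}

/-- The CVaR at level `α` of a law `μ` of costs: `(1-α)⁻¹ ∫_α^1 F⁻¹(τ) dτ`. -/
def cvar (μ : Measure ℝ) (α : ℝ) : ℝ :=
  (1 - α)⁻¹ * ∫ τ in α..1, quantile (cdf μ) τ

/-- The empirical distribution function of the observations `y t`, `t ∈ S`. -/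
def empCDF (S : Finset ℕ) (y : ℕ → ℝ) (x : ℝ) : ℝ :=
  ((S.filter (fun t => y t ≤ x)).card : ℝ) / (S.card : ℝ)

/-- The empirical CVaR at level `α` of the observations `y t`, `t ∈ S`. -/
def empCVaR (α : ℝ) (S : Finset ℕ) (y : ℕ → ℝ) : ℝ :=
  quantile (empCDF S y) α
    + (1 - α)⁻¹ * ((S.card : ℝ)⁻¹ * ∑ t ∈ S, max (y t - quantile (empCDF S y) α) 0)

/-- The standing assumptions on the laws `ν k` of the `K` arms, for the fixed level `α`:
costs lie in `[0, M]`; the distribution function `F_k` is continuous, continuously differentiable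
on `(0, M)`, and its density `f_k = F_k'` satisfies `1 / f_k (F_k⁻¹ α) ≤ m`
(in particular `f_k (F_k⁻¹ α) ≠ 0`). -/
structure ArmAssumption {K : ℕ} (ν : Fin K → Measure ℝ) (M α m : ℝ) : Prop where
  prob : ∀ k, IsProbabilityMeasure (ν k)
  bounded : ∀ k, ∀ᵐ x ∂(ν k), x ∈ Set.Icc 0 M
  continuous_cdf : ∀ k, Continuous (cdf (ν k))
  contDiffOn_cdf : ∀ k, ContDiffOn ℝ 1 (cdf (ν k)) (Set.Ioo 0 M)
  density_pos : ∀ k, 0 < deriv (cdf (ν k)) (quantile (cdf (ν k)) α)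
  density_inv_le : ∀ k, (deriv (cdf (ν k)) (quantile (cdf (ν k)) α))⁻¹ ≤ m

/-- Costs of a `K`-armed bandit. `X k t` is the cost that arm `k` yields if it is pulled at
time `t = 1, 2, …`, and `ℱ t` is the information up to time `t`. The costs at time `t + 1` have
the laws `ν k` and are independent of `ℱ t`; so the costs of each arm are i.i.d.
Nothing is required of the joint law of the costs of different arms at the same time. -/
structure IsCostProcess {Ω : Type*} {mΩ : MeasurableSpace Ω} (P : Measure Ω)
    (ℱ : Filtration ℕ mΩ) {K : ℕ} (ν : Fin K → Measure ℝ) (X : Fin K → ℕ → Ω → ℝ) : Prop where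
  adapted : ∀ k t, 1 ≤ t → Measurable[ℱ t] (X k t)
  law : ∀ k t, 1 ≤ t → P.map (X k t) = ν k
  indep : ∀ t, Indep
    (MeasurableSpace.comap (fun (ω : Ω) (k : Fin K) => X k (t + 1) ω) inferInstance) (ℱ t) P

/-- `S_k(n)`: the times `t ≤ n` at which arm `k` is pulled, along a sequence `i` of choices. -/
def pullTimes {K : ℕ} (i : ℕ → Fin K) (k : Fin K) (n : ℕ) : Finset ℕ :=
  (Finset.Icc 1 n).filter (fun t => i t = k)

/-- The confidence term `ε(n, T, K, δ)` for CVaR. -/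
def epsCVaR (M α m δ : ℝ) (K n T : ℕ) : ℝ :=
  ((1 - α)⁻¹ * (1 - 3 * δ / n) * M + 2 * (1 + (1 - α)⁻¹) * m)
    * Real.sqrt (Real.log (2 * (n : ℝ) ^ 2 * K / δ) / (2 * T))

/-- The index `B_{k,n}` of arm `k` after `n` pulls, along choices `i` and costs `x`. -/
def indexCVaR {K : ℕ} (M α m δ : ℝ) (i : ℕ → Fin K) (x : Fin K → ℕ → ℝ) (k : Fin K) (n : ℕ) : ℝ :=
  empCVaR α (pullTimes i k n) (x k) - epsCVaR M α m δ K n (pullTimes i k n).card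

/-- `I` is the sequence of choices of the RA-LCB policy with the CVaR index: `I (t+1)` is
determined by the information up to time `t`; each arm is pulled exactly once in the first
`K` pulls; the arm pulled at any later time `n + 1` has the lowest index after `n` pulls
(ties may be broken in any non-anticipating way). -/
structure IsRALCB {Ω : Type*} {mΩ : MeasurableSpace Ω} (ℱ : Filtration ℕ mΩ) {K : ℕ}
    (M α m δ : ℝ) (X : Fin K → ℕ → Ω → ℝ) (I : ℕ → Ω → Fin K) : Prop where
  predictable : ∀ t, Measurable[ℱ t] (I (t + 1))
  init : ∀ ω k, ∃! t, t ∈ Finset.Icc 1 K ∧ I t ω = k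
  argmin : ∀ ω n, K ≤ n → ∀ k,
    indexCVaR M α m δ (fun t => I t ω) (fun j t => X j t ω) (I (n + 1) ω) n
      ≤ indexCVaR M α m δ (fun t => I t ω) (fun j t => X j t ω) k n

/-- The empirical CVaR of the whole observation sequence `x_{I_t,t}`, `t = 1, …, n`. -/
def policyCVaR {Ω : Type*} {K : ℕ} (α : ℝ) (X : Fin K → ℕ → Ω → ℝ) (I : ℕ → Ω → Fin K)
    (n : ℕ) (ω : Ω) : ℝ :=
  empCVaR α (Finset.Icc 1 n) (fun t => X (I t ω) t ω)

/-- The CVaR pseudo regret up to time `n`, with optimal arm `kstar`. -/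
def pseudoRegret {Ω : Type*} [MeasurableSpace Ω] (P : Measure Ω) {K : ℕ} (α : ℝ)
    (ν : Fin K → Measure ℝ) (kstar : Fin K) (X : Fin K → ℕ → Ω → ℝ) (I : ℕ → Ω → Fin K)
    (n : ℕ) : ℝ :=
  (∫ ω, policyCVaR α X I n ω ∂P) - cvar (ν kstar) α

/-- The term `M_φ(n)`, with `C log n / n` for its term of order `O(log n / n)`. -/
def Mphi (C α m δ : ℝ) (n : ℕ) : ℝ :=
  max α (1 - α) * (C * (Real.log n / n)) * m
    + 2 * m * Real.sqrt (Real.log (4 * n / δ) / (2 * n))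

/-- The term `M_k(n)` of an arm with gap `Δ`. -/
def Mk (M α m δ : ℝ) (K : ℕ) (Δ : ℝ) (n : ℕ) : ℝ :=
  2 * Real.log (2 * (n : ℝ) ^ 2 * K / δ)
      * ((2 * (1 + (1 - α)⁻¹) * m + (1 - α)⁻¹ * M)
          / (Δ - (1 - α)⁻¹ * (4 * δ / ((n : ℝ) ^ 2 * K)) * M)) ^ 2
    + 3 * δ

/-- The upper bound for the pseudo regret, with gaps `Δ k`; `j` is the arm whose gap occurs in
the last term. -/
def regretBound (C M α m δ : ℝ) {K : ℕ} (kstar : Fin K) (Δ : Fin K → ℝ) (j : Fin K) (n : ℕ) : ℝ :=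
  (1 - 4 * δ / n)
      * (Mphi C α m δ n
        + (1 - α)⁻¹ * (1 / n)
            * ∑ k ∈ Finset.univ.filter (fun k => k ≠ kstar), Mk M α m δ K (Δ k) n * (M + Δ k))
    + 4 * δ / n * (((1 - α)⁻¹ + 1) * M + (1 - α)⁻¹ * Δ j)

end

end RiskBandit

namespace RiskBandit

/-! The regret is in fact of order `log n / n`, so the term `C * (log n / n)` of `Mphi` alone can
carry it once `C` is large enough.

The tool is the Rockafellar–Uryasev formula: the CVaR of a law is the minimum over `q` of `q + (1 -
α)⁻¹ 𝔼 (Y - q)₊`, attained at the `α`-quantile. Applied to the empirical law of the whole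
observation sequence, with `q` the true quantile of the best arm, it bounds the policy CVaR by an
average of excesses `(y_t - q)₊`. Replacing each observation by the cost the best arm would have
yielded at that time costs at most `M` per suboptimal pull, and those counterfactual excesses have
exactly the right mean. Hence the regret is at most `(1 - α)⁻¹ M / n` times the expected number of
suboptimal pulls (`pseudoRegret_le_sum`).

That number is `O(log n)` by the usual confidence-bound argument (`exists_sum_measureReal_pull_le`).
A suboptimal arm is pulled only if it has few pulls so far, or the best arm's index exceeds its
CVaR, or the pulled arm's index falls short by its whole gap. The last two events reduce to
Hoeffding bounds for means at a fixed `q`: the minimum formula bounds the empirical CVaR from above,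
and convexity in `q` bounds it from below (`le_empCVaR`), so no concentration of empirical quantiles
is needed.

The factor `1 - 4δ/n` is bounded below over integers `n > 4δ`; at `n = 4δ` it vanishes, and the last
term of the bound already exceeds the range of the CVaR. The asymptotic claims are comparisons with
`√(log n / n)`. -/

/-! ### Quantiles, and CVaR as a minimum. -/

/-- Right continuity makes the infimum defining the quantile attained, which gives a Galois
connection. It is the only access to quantiles needed below. -/
theorem quantile_cdf_le_iff (μ : Measure ℝ) [IsProbabilityMeasure μ] {τ : ℝ}
    (hτ : τ ∈ Set.Ioo (0 : ℝ) 1) (x : ℝ) :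
    quantile (cdf μ) τ ≤ x ↔ τ ≤ cdf μ x := by
  have hne : {x : ℝ | τ ≤ cdf μ x}.Nonempty :=
    ((tendsto_cdf_atTop μ).eventually (eventually_ge_nhds hτ.2)).exists
  have hbdd : BddBelow {x : ℝ | τ ≤ cdf μ x} := by
    obtain ⟨a, ha⟩ := ((tendsto_cdf_atBot μ).eventually (eventually_lt_nhds hτ.1)).exists
    refine ⟨a, fun y hy => ?_⟩
    by_contra! h
    have := monotone_cdf μ h.le
    simp only [Set.mem_ofPred_eq] at hy
    linarith
  refine ⟨fun h => ?_, fun h => csInf_le hbdd h⟩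
  refine le_trans ?_ (monotone_cdf μ h)
  have hr := ((cdf μ).right_continuous (quantile (cdf μ) τ)).tendsto.mono_left
    (nhdsWithin_mono _ Set.Ioi_subset_Ici_self)
  refine ge_of_tendsto hr ?_
  filter_upwards [self_mem_nhdsWithin] with y hy
  obtain ⟨z, hz, hzy⟩ := exists_lt_of_csInf_lt hne hy
  exact le_trans hz (monotone_cdf μ hzy.le)

theorem monotoneOn_quantile_cdf (μ : Measure ℝ) [IsProbabilityMeasure μ] :
    MonotoneOn (quantile (cdf μ)) (Set.Ioo 0 1) := by
  intro a ha b hb hab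
  rw [quantile_cdf_le_iff μ ha]
  exact hab.trans ((quantile_cdf_le_iff μ hb _).1 le_rfl)

theorem aemeasurable_quantile_cdf (μ : Measure ℝ) [IsProbabilityMeasure μ] :
    AEMeasurable (quantile (cdf μ)) (volume.restrict (Set.Ioo 0 1)) :=
  aemeasurable_restrict_of_monotoneOn measurableSet_Ioo (monotoneOn_quantile_cdf μ)

/-- The quantile function pushes the uniform law on `(0, 1)` to the law itself. -/
theorem map_quantile_cdf (μ : Measure ℝ) [IsProbabilityMeasure μ] :
    (volume.restrict (Set.Ioo (0 : ℝ) 1)).map (quantile (cdf μ)) = μ := by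
  have hm := aemeasurable_quantile_cdf μ
  have : IsProbabilityMeasure (volume.restrict (Set.Ioo (0 : ℝ) 1)) :=
    ⟨by simp⟩
  have := Measure.isProbabilityMeasure_map hm
  refine Measure.ext_of_Iic _ _ fun x => ?_
  rw [Measure.map_apply_of_aemeasurable hm measurableSet_Iic]
  have h1 : (volume.restrict (Set.Ioo (0 : ℝ) 1)) (quantile (cdf μ) ⁻¹' Set.Iic x)
      = (volume.restrict (Set.Ioo (0 : ℝ) 1)) (Set.Iic (cdf μ x)) := by
    refine measure_congr ?_
    filter_upwards [ae_restrict_mem measurableSet_Ioo] with τ hτ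
    exact propext (quantile_cdf_le_iff μ hτ x)
  rw [h1, Measure.restrict_apply measurableSet_Iic]
  have h0 := cdf_nonneg μ x
  have h2 := cdf_le_one μ x
  have h3 : volume (Set.Iic (cdf μ x) ∩ Set.Ioo (0 : ℝ) 1) = ENNReal.ofReal (cdf μ x) := by
    refine le_antisymm ?_ ?_
    · calc _ ≤ volume (Set.Ioc 0 (cdf μ x)) :=
            measure_mono (by intro y hy; exact ⟨hy.2.1, hy.1⟩)
        _ = _ := by simp
    · calc _ = volume (Set.Ioo 0 (cdf μ x)) := by simp
        _ ≤ _ := measure_mono (by intro y hy; exact ⟨hy.2.le, hy.1, hy.2.trans_le h2⟩)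
  rw [h3, cdf_eq_real, ofReal_measureReal]

theorem integral_comp_quantile (μ : Measure ℝ) [IsProbabilityMeasure μ] {f : ℝ → ℝ}
    (hf : AEStronglyMeasurable f μ) :
    ∫ τ in Set.Ioo (0 : ℝ) 1, f (quantile (cdf μ) τ) = ∫ x, f x ∂μ := by
  conv_rhs => rw [← map_quantile_cdf μ]
  rw [integral_map (aemeasurable_quantile_cdf μ)]
  rwa [map_quantile_cdf]

theorem integrableOn_comp_quantile (μ : Measure ℝ) [IsProbabilityMeasure μ] {f : ℝ → ℝ}
    (hf : Integrable f μ) :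
    IntegrableOn (fun τ => f (quantile (cdf μ) τ)) (Set.Ioo (0 : ℝ) 1) := by
  have : Integrable f ((volume.restrict (Set.Ioo (0 : ℝ) 1)).map (quantile (cdf μ))) := by
    rwa [map_quantile_cdf]
  exact (integrable_map_measure this.1 (aemeasurable_quantile_cdf μ)).1 this

theorem integrable_posPart_sub {μ : Measure ℝ} [IsProbabilityMeasure μ]
    (hμ : Integrable (fun x : ℝ => x) μ) (q : ℝ) :
    Integrable (fun x => max (x - q) 0) μ :=
  (hμ.sub (integrable_const q)).pos_part

/-- The function `q ↦ q + (1 - α)⁻¹ 𝔼 (Y - q)₊`, whose minimum is the CVaR. -/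
noncomputable def cvarObjective (μ : Measure ℝ) (α q : ℝ) : ℝ :=
  q + (1 - α)⁻¹ * ∫ x, max (x - q) 0 ∂μ

theorem cvar_eq_add (μ : Measure ℝ) [IsProbabilityMeasure μ]
    (hμ : Integrable (fun x : ℝ => x) μ) {α : ℝ} (hα : α ∈ Set.Ioo (0 : ℝ) 1) (q : ℝ) :
    cvar μ α = q + (1 - α)⁻¹ * ∫ τ in Set.Ioo α 1, (quantile (cdf μ) τ - q) := by
  have hsub : Set.Ioo α 1 ⊆ Set.Ioo (0 : ℝ) 1 := Set.Ioo_subset_Ioo_left hα.1.le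
  have hint := (integrableOn_comp_quantile μ hμ).mono_set hsub
  rw [integral_sub hint (integrable_const q), cvar,
    intervalIntegral.integral_of_le hα.2.le, integral_Ioc_eq_integral_Ioo]
  have h1 : (1 - α) ≠ 0 := by have := hα.2; linarith
  have h2 : ∫ _ in Set.Ioo α 1, q = (1 - α) * q := by
    simp [hα.2.le]
  rw [h2]
  field_simp
  ring

/-- Under the uniform variable, `F⁻¹ - q` on `(α, 1)` is at most its positive part, whose integral
only grows on passing to `(0, 1)`. -/
theorem cvar_le_cvarObjective (μ : Measure ℝ) [IsProbabilityMeasure μ]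
    (hμ : Integrable (fun x : ℝ => x) μ) {α : ℝ} (hα : α ∈ Set.Ioo (0 : ℝ) 1) (q : ℝ) :
    cvar μ α ≤ cvarObjective μ α q := by
  have hsub : Set.Ioo α 1 ⊆ Set.Ioo (0 : ℝ) 1 := Set.Ioo_subset_Ioo_left hα.1.le
  have hi := integrableOn_comp_quantile μ (integrable_posPart_sub hμ q)
  have hint := (integrableOn_comp_quantile μ hμ).mono_set hsub
  have h1 : 0 ≤ (1 - α)⁻¹ := inv_nonneg.2 (by linarith [hα.2])
  rw [cvar_eq_add μ hμ hα q, cvarObjective,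
    ← integral_comp_quantile μ (integrable_posPart_sub hμ q).1]
  gcongr
  calc _ ≤ ∫ τ in Set.Ioo α 1, max (quantile (cdf μ) τ - q) 0 :=
        integral_mono (hint.sub (integrable_const q)) (hi.mono_set hsub) fun τ => le_max_left _ _
    _ ≤ _ := setIntegral_mono_set hi (Filter.Eventually.of_forall fun τ => le_max_right _ _)
        hsub.eventuallyLE

/-- Both inequalities of the previous bound are equalities here, since `F⁻¹(τ) - F⁻¹(α)` is
nonnegative for `τ > α` and nonpositive for `τ ≤ α`. -/
theorem cvarObjective_quantile (μ : Measure ℝ) [IsProbabilityMeasure μ]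
    (hμ : Integrable (fun x : ℝ => x) μ) {α : ℝ} (hα : α ∈ Set.Ioo (0 : ℝ) 1) :
    cvarObjective μ α (quantile (cdf μ) α) = cvar μ α := by
  rw [cvar_eq_add μ hμ hα (quantile (cdf μ) α), cvarObjective,
    ← integral_comp_quantile μ (integrable_posPart_sub hμ _).1]
  congr 2
  have hsub : Set.Ioo α 1 ⊆ Set.Ioo (0 : ℝ) 1 := Set.Ioo_subset_Ioo_left hα.1.le
  rw [setIntegral_eq_of_subset_of_forall_sdiff_eq_zero measurableSet_Ioo hsub]
  · refine setIntegral_congr_fun measurableSet_Ioo fun τ hτ => ?_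
    have := monotoneOn_quantile_cdf μ hα (hsub hτ) hτ.1.le
    exact max_eq_left (by linarith)
  · intro τ hτ
    have : τ ≤ α := by
      by_contra! h
      exact hτ.2 ⟨h, hτ.1.2⟩
    have := monotoneOn_quantile_cdf μ hτ.1 hα this
    exact max_eq_right (by linarith)

/-! ### Empirical CVaR. -/

/-- The empirical law of the observations `y t`, `t ∈ S`. -/
noncomputable def empMeasure (S : Finset ℕ) (y : ℕ → ℝ) : Measure ℝ :=
  (S.card : ENNReal)⁻¹ • ∑ t ∈ S, Measure.dirac (y t)

theorem isProbabilityMeasure_empMeasure {S : Finset ℕ} (hS : S.Nonempty) (y : ℕ → ℝ) :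
    IsProbabilityMeasure (empMeasure S y) := by
  constructor
  simp only [empMeasure, Measure.smul_apply, Measure.finsetSum_apply, measure_univ,
    Finset.sum_const, smul_eq_mul, nsmul_eq_mul, mul_one]
  exact ENNReal.inv_mul_cancel (by simp [hS.ne_empty]) (by simp)

theorem integrable_empMeasure (S : Finset ℕ) (y : ℕ → ℝ) (f : ℝ → ℝ) :
    Integrable f (empMeasure S y) := by
  rcases S.eq_empty_or_nonempty with rfl | hS
  · simp [empMeasure]
  · refine Integrable.smul_measure ?_ (by simp [hS.ne_empty])
    rw [integrable_finsetSum_measure]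
    intro t _
    exact integrable_dirac (by simp)

theorem integral_empMeasure (S : Finset ℕ) (y : ℕ → ℝ) (f : ℝ → ℝ) :
    ∫ x, f x ∂(empMeasure S y) = (S.card : ℝ)⁻¹ * ∑ t ∈ S, f (y t) := by
  rw [empMeasure, integral_smul_measure, integral_finsetSum_measure]
  · simp
  · intro t _
    exact integrable_dirac (by simp)

/-- This identity transfers the quantile and CVaR facts for laws to samples. -/
theorem cdf_empMeasure {S : Finset ℕ} (hS : S.Nonempty) (y : ℕ → ℝ) :
    ⇑(cdf (empMeasure S y)) = empCDF S y := by
  have := isProbabilityMeasure_empMeasure hS y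
  funext x
  rw [cdf_eq_real, ← integral_indicator_one measurableSet_Iic, integral_empMeasure, empCDF,
    Finset.card_filter]
  simp only [Set.indicator_apply, Set.mem_Iic, Pi.one_apply, Nat.cast_sum, Nat.cast_ite,
    Nat.cast_one, Nat.cast_zero]
  rw [mul_comm, div_eq_mul_inv]

theorem quantile_empCDF_le_iff {S : Finset ℕ} (hS : S.Nonempty) (y : ℕ → ℝ) {τ : ℝ}
    (hτ : τ ∈ Set.Ioo (0 : ℝ) 1) (x : ℝ) :
    quantile (empCDF S y) τ ≤ x ↔ τ ≤ empCDF S y x := by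
  have := isProbabilityMeasure_empMeasure hS y
  rw [← cdf_empMeasure hS, quantile_cdf_le_iff _ hτ]

/-- The empirical CVaR is the minimum over `q` of the empirical objective. -/
theorem empCVaR_le {S : Finset ℕ} (hS : S.Nonempty) (y : ℕ → ℝ) {α : ℝ}
    (hα : α ∈ Set.Ioo (0 : ℝ) 1) (q : ℝ) :
    empCVaR α S y ≤ q + (1 - α)⁻¹ * ((S.card : ℝ)⁻¹ * ∑ t ∈ S, max (y t - q) 0) := by
  have := isProbabilityMeasure_empMeasure hS y
  have hi := integrable_empMeasure S y (fun x => x)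
  have h1 : empCVaR α S y = cvarObjective (empMeasure S y) α (quantile (empCDF S y) α) := by
    rw [cvarObjective, integral_empMeasure, empCVaR]
  have h2 := cvar_le_cvarObjective (empMeasure S y) hi hα q
  rw [← cvarObjective_quantile _ hi hα, cdf_empMeasure hS, ← h1, cvarObjective,
    integral_empMeasure] at h2
  exact h2

theorem quantile_empCDF_mem_Icc {S : Finset ℕ} (hS : S.Nonempty) {y : ℕ → ℝ} {M α : ℝ}
    (hα : α ∈ Set.Ioo (0 : ℝ) 1) (hy : ∀ t ∈ S, y t ∈ Set.Icc 0 M) :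
    quantile (empCDF S y) α ∈ Set.Icc 0 M := by
  have hc : (0 : ℝ) < S.card := by exact_mod_cast hS.card_pos
  constructor
  · refine le_of_forall_lt fun x hx => ?_
    rw [← not_le, quantile_empCDF_le_iff hS y hα, empCDF, Finset.filter_false_of_mem]
    · simpa using hα.1
    · intro t ht
      have := (hy t ht).1
      linarith
  · rw [quantile_empCDF_le_iff hS y hα, empCDF, Finset.filter_true_of_mem fun t ht => (hy t ht).2,
      div_self hc.ne']
    exact hα.2.le

theorem empCVaR_mem_Icc {S : Finset ℕ} (hS : S.Nonempty) {y : ℕ → ℝ} {M α : ℝ}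
    (hα : α ∈ Set.Ioo (0 : ℝ) 1) (hy : ∀ t ∈ S, y t ∈ Set.Icc 0 M) :
    empCVaR α S y ∈ Set.Icc 0 ((1 - α)⁻¹ * M) := by
  have hc : (0 : ℝ) < S.card := by exact_mod_cast hS.card_pos
  have h1 : 0 ≤ (1 - α)⁻¹ := inv_nonneg.2 (by linarith [hα.2])
  constructor
  · have := (quantile_empCDF_mem_Icc hS hα hy).1
    unfold empCVaR
    positivity
  · refine (empCVaR_le hS y hα 0).trans ?_
    rw [zero_add]
    gcongr
    rw [inv_mul_le_iff₀ hc, ← nsmul_eq_mul]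
    refine Finset.sum_le_card_nsmul _ _ _ fun t ht => ?_
    have := hy t ht
    simpa using ⟨this.2, this.1.trans this.2⟩

/-- Lower bound of the empirical CVaR by empirical means at a fixed `q`. -/
theorem le_empCVaR {S : Finset ℕ} (hS : S.Nonempty) {y : ℕ → ℝ} {M α q : ℝ}
    (hα : α ∈ Set.Ioo (0 : ℝ) 1) (hy : ∀ t ∈ S, y t ∈ Set.Icc 0 M) (hq : q ∈ Set.Icc 0 M) :
    q + (1 - α)⁻¹ * ((S.card : ℝ)⁻¹ * ∑ t ∈ S, max (y t - q) 0)
      - M * |1 - (S.card : ℝ)⁻¹ * ∑ t ∈ S, (Set.Ioi q).indicator (fun _ => (1 - α)⁻¹) (y t)|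
      ≤ empCVaR α S y := by
  have hc : (0 : ℝ) < S.card := by exact_mod_cast hS.card_pos
  have h1 : 0 ≤ (1 - α)⁻¹ := inv_nonneg.2 (by linarith [hα.2])
  have hr := quantile_empCDF_mem_Icc hS hα hy
  unfold empCVaR
  set r := quantile (empCDF S y) α
  set c := (1 - α)⁻¹
  set W := (S.card : ℝ)⁻¹ * ∑ t ∈ S, (Set.Ioi q).indicator (fun _ => c) (y t) with hW
  -- Subgradient inequality: `r ↦ c · mean (y - r)₊` is convex and has `-W` as a subgradient at `q`.
  -- The full objective thus has slope `1 - W` there, and `|q - r| ≤ M`.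
  have key : c * ((S.card : ℝ)⁻¹ * ∑ t ∈ S, max (y t - q) 0) + (q - r) * W
      ≤ c * ((S.card : ℝ)⁻¹ * ∑ t ∈ S, max (y t - r) 0) := by
    have : ∑ t ∈ S, (c * max (y t - q) 0 + (q - r) * (Set.Ioi q).indicator (fun _ => c) (y t))
        ≤ ∑ t ∈ S, c * max (y t - r) 0 := by
      refine Finset.sum_le_sum fun t _ => ?_
      by_cases h : q < y t
      · rw [Set.indicator_of_mem (by exact h), max_eq_left (by linarith)]
        nlinarith [le_max_left (y t - r) 0]
      · rw [Set.indicator_of_notMem (by exact h), max_eq_right (by linarith)]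
        have := mul_nonneg h1 (le_max_right (y t - r) 0)
        linarith
    have h2 := mul_le_mul_of_nonneg_left this (inv_nonneg.2 hc.le)
    rw [Finset.sum_add_distrib, ← Finset.mul_sum, ← Finset.mul_sum, ← Finset.mul_sum] at h2
    rw [hW]
    linarith
  have h3 : (q - r) * (1 - W) ≤ M * |1 - W| := by
    refine (le_abs_self _).trans ?_
    rw [abs_mul]
    gcongr
    rw [abs_le]
    constructor <;> linarith [hr.1, hr.2, hq.1, hq.2]
  linarith

theorem measurable_empCVaR {Ω : Type*} [MeasurableSpace Ω] {S : Finset ℕ} (hS : S.Nonempty)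
    {α : ℝ} (hα : α ∈ Set.Ioo (0 : ℝ) 1) {Y : ℕ → Ω → ℝ} (hY : ∀ t ∈ S, Measurable (Y t)) :
    Measurable fun ω => empCVaR α S (fun t => Y t ω) := by
  have hq : Measurable fun ω => quantile (empCDF S fun t => Y t ω) α := by
    refine measurable_of_Iic fun x => ?_
    have : (fun ω => quantile (empCDF S fun t => Y t ω) α) ⁻¹' Set.Iic x
        = {ω | α ≤ empCDF S (fun t => Y t ω) x} := by
      ext ω
      exact quantile_empCDF_le_iff hS _ hα x
    rw [this]
    refine measurableSet_le measurable_const ?_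
    unfold empCDF
    refine Measurable.div_const ?_ _
    simp only [Finset.card_filter, Nat.cast_sum, Nat.cast_ite, Nat.cast_one, Nat.cast_zero]
    exact Finset.measurable_sum _ fun t ht =>
      Measurable.ite (measurableSet_le (hY t ht) measurable_const) measurable_const
        measurable_const
  unfold empCVaR
  refine hq.add (measurable_const.mul (measurable_const.mul ?_))
  exact Finset.measurable_sum _ fun t ht => ((hY t ht).sub hq).max measurable_const

/-! ### Concentration for adaptively sampled costs. -/

/-- Hoeffding's lemma, in the form of an exponential of mean at most one. -/
theorem lintegral_exp_hoeffding_le_one (μ : Measure ℝ) [IsProbabilityMeasure μ] {g : ℝ → ℝ}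
    (hg : Measurable g) {l u : ℝ} (hb : ∀ᵐ x ∂μ, g x ∈ Set.Icc l u) (r : ℝ) :
    ∫⁻ x, ENNReal.ofReal (Real.exp (r * (g x - ∫ z, g z ∂μ) - r ^ 2 * (u - l) ^ 2 / 8)) ∂μ ≤ 1 := by
  have h := hasSubgaussianMGF_of_mem_Icc hg.aemeasurable hb
  have h1 := h.mgf_le r
  have h2 := h.integrable_exp_mul r
  simp only [Real.exp_sub]
  rw [← ofReal_integral_eq_lintegral_ofReal (h2.div_const _)
    (Filter.Eventually.of_forall fun x => by positivity), ← ENNReal.ofReal_one]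
  refine ENNReal.ofReal_le_ofReal ?_
  rw [integral_div, div_le_one (Real.exp_pos _)]
  refine h1.trans (Real.exp_le_exp.2 (le_of_eq ?_))
  simp only [NNReal.coe_pow, NNReal.coe_div, coe_nnnorm, Real.norm_eq_abs, NNReal.coe_ofNat,
    div_pow, sq_abs]
  ring

theorem pullTimes_succ {K : ℕ} (i : ℕ → Fin K) (k : Fin K) (t : ℕ) :
    pullTimes i k (t + 1)
      = if i (t + 1) = k then insert (t + 1) (pullTimes i k t) else pullTimes i k t := by
  unfold pullTimes
  rw [← Finset.insert_Icc_right_eq_Icc_add_one (by omega), Finset.filter_insert]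

theorem notMem_pullTimes_succ {K : ℕ} (i : ℕ → Fin K) (k : Fin K) (t : ℕ) :
    t + 1 ∉ pullTimes i k t := by
  simp [pullTimes]

theorem card_pullTimes_le {K : ℕ} (i : ℕ → Fin K) (k : Fin K) (t : ℕ) :
    (pullTimes i k t).card ≤ t := by
  simpa [pullTimes] using Finset.card_filter_le (Finset.Icc 1 t) (fun s => i s = k)

section Concentration

variable {Ω : Type*} {mΩ : MeasurableSpace Ω} {P : Measure Ω} {ℱ : Filtration ℕ mΩ} {K : ℕ}
  {ν : Fin K → Measure ℝ} {X : Fin K → ℕ → Ω → ℝ} {I : ℕ → Ω → Fin K}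

theorem measurableSet_pull (hI : ∀ t, Measurable[ℱ t] (I (t + 1))) (k : Fin K) (t : ℕ) :
    MeasurableSet[ℱ t] {ω | I (t + 1) ω = k} :=
  hI t (measurableSet_singleton k)

theorem measurable_sum_pullTimes (hX : IsCostProcess P ℱ ν X)
    (hI : ∀ t, Measurable[ℱ t] (I (t + 1))) (k : Fin K) {ξ : ℝ → ℝ} (hξ : Measurable ξ) (t : ℕ) :
    Measurable[ℱ t] fun ω => ∑ s ∈ pullTimes (fun s => I s ω) k t, ξ (X k s ω) := by
  simp only [pullTimes, Finset.sum_filter]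
  refine Finset.measurable_sum _ fun s hs => ?_
  obtain ⟨h1, h2⟩ := Finset.mem_Icc.1 hs
  obtain ⟨s, rfl⟩ : ∃ s', s = s' + 1 := ⟨s - 1, by omega⟩
  refine Measurable.ite ?_ ?_ measurable_const
  · exact ℱ.mono (by omega) _ (measurableSet_pull hI k s)
  · exact hξ.comp ((hX.adapted k (s + 1) h1).mono (ℱ.mono h2) le_rfl)

/-- The exponential supermartingale of the costs collected from one arm. -/
theorem lintegral_exp_sum_pullTimes_le_one [IsProbabilityMeasure P]
    (hX : IsCostProcess P ℱ ν X) (hI : ∀ t, Measurable[ℱ t] (I (t + 1))) (k : Fin K)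
    {ξ : ℝ → ℝ} (hξ : Measurable ξ)
    (h1 : ∫⁻ x, ENNReal.ofReal (Real.exp (ξ x)) ∂(ν k) ≤ 1) (t : ℕ) :
    ∫⁻ ω, ENNReal.ofReal
      (Real.exp (∑ s ∈ pullTimes (fun s => I s ω) k t, ξ (X k s ω))) ∂P ≤ 1 := by
  induction t with
  | zero => simp [pullTimes]
  | succ t ih =>
    have hZ : Measurable[ℱ t] fun ω => ENNReal.ofReal
        (Real.exp (∑ s ∈ pullTimes (fun s => I s ω) k t, ξ (X k s ω))) :=
      ENNReal.measurable_ofReal.comp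
        (Real.measurable_exp.comp (measurable_sum_pullTimes hX hI k hξ t))
    set Z : Ω → ENNReal := fun ω => ENNReal.ofReal
        (Real.exp (∑ s ∈ pullTimes (fun s => I s ω) k t, ξ (X k s ω))) with hZdef
    set A : Set Ω := {ω | I (t + 1) ω = k} with hAdef
    have hA : MeasurableSet[ℱ t] A := measurableSet_pull hI k t
    set e : Ω → ENNReal := fun ω => ENNReal.ofReal (Real.exp (ξ (X k (t + 1) ω))) with hedef
    have hfe : Measurable fun x => ENNReal.ofReal (Real.exp (ξ x)) :=
      ENNReal.measurable_ofReal.comp (Real.measurable_exp.comp hξ)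
    have he : Measurable[MeasurableSpace.comap
        (fun (ω : Ω) (k : Fin K) => X k (t + 1) ω) inferInstance] e :=
      Measurable.comp (g := fun x : Fin K → ℝ => ENNReal.ofReal (Real.exp (ξ (x k))))
        (hfe.comp (measurable_pi_apply k)) (comap_measurable _)
    have hXm : ∀ j, Measurable (X j (t + 1)) := fun j =>
      (hX.adapted j (t + 1) (by omega)).mono (ℱ.le _) le_rfl
    have hcomap : MeasurableSpace.comap
        (fun (ω : Ω) (k : Fin K) => X k (t + 1) ω) inferInstance ≤ mΩ :=
      (measurable_pi_lambda _ hXm).comap_le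
    -- Off `A` nothing changes; on `A` there is one new factor `e`, independent of `ℱ t` and of mean
    -- at most one, while `A` and `Z` are known at time `t`.
    have hsplit : ∀ ω, ENNReal.ofReal
        (Real.exp (∑ s ∈ pullTimes (fun s => I s ω) k (t + 1), ξ (X k s ω)))
        = Aᶜ.indicator Z ω + A.indicator Z ω * e ω := by
      intro ω
      rw [pullTimes_succ]
      by_cases h : I (t + 1) ω = k
      · rw [if_pos h, Finset.sum_insert (notMem_pullTimes_succ _ _ _), Real.exp_add,
          ENNReal.ofReal_mul (Real.exp_pos _).le, Set.indicator_of_notMem (by simpa [A] using h),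
          Set.indicator_of_mem (by exact h), zero_add, mul_comm]
      · rw [if_neg h, Set.indicator_of_mem (by exact h), Set.indicator_of_notMem (by exact h),
          zero_mul, add_zero]
    simp only [hsplit]
    rw [lintegral_add_left ((hZ.indicator hA.compl).mono (ℱ.le t) le_rfl),
      lintegral_mul_eq_lintegral_mul_lintegral_of_independent_measurableSpace (ℱ.le t) hcomap
        (hX.indep t).symm (hZ.indicator hA) he]
    have he1 : ∫⁻ ω, e ω ∂P ≤ 1 := by
      rw [← hX.law k (t + 1) (by omega), lintegral_map hfe (hXm k)] at h1
      exact h1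
    calc _ ≤ ∫⁻ ω, Aᶜ.indicator Z ω ∂P + ∫⁻ ω, A.indicator Z ω ∂P := by
          gcongr
          exact mul_le_of_le_one_right' he1
      _ = ∫⁻ ω, Z ω ∂P := by
          rw [← lintegral_add_left ((hZ.indicator hA.compl).mono (ℱ.le t) le_rfl)]
          refine lintegral_congr fun ω => ?_
          rw [add_comm]
          exact Set.indicator_self_add_compl_apply A Z ω
      _ ≤ 1 := ih

/-- Hoeffding's inequality for the costs collected from one arm, at a fixed number of pulls. -/
theorem measureReal_sum_pullTimes_ge_le [IsProbabilityMeasure P]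
    (hX : IsCostProcess P ℱ ν X) (hI : ∀ t, Measurable[ℱ t] (I (t + 1))) (k : Fin K)
    [IsProbabilityMeasure (ν k)] {g : ℝ → ℝ} (hg : Measurable g) {l u : ℝ} (hlu : l < u)
    (hb : ∀ᵐ x ∂(ν k), g x ∈ Set.Icc l u) {a : ℝ} (ha : 0 ≤ a) (t T : ℕ) :
    P.real {ω | (pullTimes (fun s => I s ω) k t).card = T ∧
        a * T ≤ ∑ s ∈ pullTimes (fun s => I s ω) k t, (g (X k s ω) - ∫ z, g z ∂(ν k))}
      ≤ Real.exp (-(2 * T * (a / (u - l)) ^ 2)) := by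
  have hul : 0 < u - l := by linarith
  -- This `r` maximizes the Chernoff exponent `r a - r² (u - l)² / 8`.
  set r := 4 * a / (u - l) ^ 2 with hr
  have hr0 : 0 ≤ r := by positivity
  set ξ : ℝ → ℝ := fun x => r * (g x - ∫ z, g z ∂(ν k)) - r ^ 2 * (u - l) ^ 2 / 8 with hξdef
  have hξ : Measurable ξ := ((hg.sub_const _).const_mul _).sub_const _
  have hE := lintegral_exp_sum_pullTimes_le_one hX hI k hξ
    (lintegral_exp_hoeffding_le_one (ν k) hg hb r) t
  have hm := (measurable_sum_pullTimes hX hI k hξ t).mono (ℱ.le t) le_rfl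
  have hM := meas_ge_le_lintegral_div (μ := P) (ε := ENNReal.ofReal (Real.exp
    (2 * T * (a / (u - l)) ^ 2)))
    (ENNReal.measurable_ofReal.comp (Real.measurable_exp.comp hm)).aemeasurable
    (by simp [Real.exp_pos]) (by simp)
  have hle : P {ω | (pullTimes (fun s => I s ω) k t).card = T ∧
        a * T ≤ ∑ s ∈ pullTimes (fun s => I s ω) k t, (g (X k s ω) - ∫ z, g z ∂(ν k))}
      ≤ ENNReal.ofReal (Real.exp (-(2 * T * (a / (u - l)) ^ 2))) := by
    refine (measure_mono ?_).trans (hM.trans ?_)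
    · rintro ω ⟨hT, hω⟩
      refine ENNReal.ofReal_le_ofReal (Real.exp_le_exp.2 ?_)
      simp only [hξdef]
      rw [Finset.sum_sub_distrib, ← Finset.mul_sum, Finset.sum_const, hT, nsmul_eq_mul]
      have := mul_le_mul_of_nonneg_left hω hr0
      have h3 : r * (a * T) - T * (r ^ 2 * (u - l) ^ 2 / 8) = 2 * T * (a / (u - l)) ^ 2 := by
        rw [hr]
        field_simp
        ring
      linarith
    · rw [Real.exp_neg, ENNReal.ofReal_inv_of_pos (Real.exp_pos _), ENNReal.div_eq_inv_mul]
      exact mul_le_of_le_one_right' hE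
  exact ENNReal.toReal_le_of_le_ofReal (Real.exp_pos _).le hle

end Concentration

/-! ### Bounded laws with continuous distribution function. -/

section Law

variable {μ : Measure ℝ} [IsProbabilityMeasure μ] {M α : ℝ}

theorem integrable_id_of_bounded (hb : ∀ᵐ x ∂μ, x ∈ Set.Icc 0 M) :
    Integrable (fun x : ℝ => x) μ :=
  Integrable.of_mem_Icc 0 M measurable_id.aemeasurable hb

theorem cdf_eq_one_of_bounded (hb : ∀ᵐ x ∂μ, x ∈ Set.Icc 0 M) : cdf μ M = 1 := by
  have h : Set.Iic M ∈ ae μ := by filter_upwards [hb] with x hx using hx.2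
  rw [cdf_eq_real, measureReal_def, (mem_ae_iff_prob_eq_one measurableSet_Iic).1 h,
    ENNReal.toReal_one]

theorem cdf_eq_zero_of_bounded (hb : ∀ᵐ x ∂μ, x ∈ Set.Icc 0 M) {x : ℝ} (hx : x < 0) :
    cdf μ x = 0 := by
  rw [cdf_eq_real, measureReal_eq_zero_iff]
  refine measure_mono_null (t := {x | ¬ x ∈ Set.Icc 0 M}) ?_ hb
  intro y hy h
  have := h.1
  simp only [Set.mem_Iic] at hy
  linarith

theorem quantile_cdf_mem_Icc (hb : ∀ᵐ x ∂μ, x ∈ Set.Icc 0 M) (hα : α ∈ Set.Ioo (0 : ℝ) 1) :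
    quantile (cdf μ) α ∈ Set.Icc 0 M := by
  constructor
  · refine le_of_forall_lt fun x hx => ?_
    rw [← not_le, quantile_cdf_le_iff μ hα, cdf_eq_zero_of_bounded hb hx]
    simpa using hα.1
  · rw [quantile_cdf_le_iff μ hα, cdf_eq_one_of_bounded hb]
    exact hα.2.le

theorem cdf_quantile_of_continuous (hα : α ∈ Set.Ioo (0 : ℝ) 1) (hc : Continuous (cdf μ)) :
    cdf μ (quantile (cdf μ) α) = α := by
  refine le_antisymm ?_ ((quantile_cdf_le_iff μ hα _).1 le_rfl)
  refine le_of_tendsto (hc.continuousWithinAt (s := Set.Iio (quantile (cdf μ) α))) ?_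
  filter_upwards [self_mem_nhdsWithin] with x hx
  by_contra! h
  have := (quantile_cdf_le_iff μ hα x).2 h.le
  exact absurd hx (not_lt.2 this)

theorem pos_of_bounded_of_continuous (hb : ∀ᵐ x ∂μ, x ∈ Set.Icc 0 M) (hc : Continuous (cdf μ)) :
    0 < M := by
  by_contra! h
  have h0 : cdf μ 0 ≤ 0 := by
    refine le_of_tendsto (hc.continuousWithinAt (s := Set.Iio 0)) ?_
    filter_upwards [self_mem_nhdsWithin] with x hx
    exact (cdf_eq_zero_of_bounded hb hx).le
  have := monotone_cdf μ h
  rw [cdf_eq_one_of_bounded hb] at this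
  linarith

/-- Continuity gives the tail beyond the quantile mass exactly `1 - α`. So the slope `1 - W` in
`le_empCVaR` has mean zero. -/
theorem integral_indicator_Ioi_quantile (hα : α ∈ Set.Ioo (0 : ℝ) 1) (hc : Continuous (cdf μ)) :
    ∫ x, (Set.Ioi (quantile (cdf μ) α)).indicator (fun _ => (1 - α)⁻¹) x ∂μ = 1 := by
  rw [integral_indicator_const _ measurableSet_Ioi, ← Set.compl_Iic,
    probReal_compl_eq_one_sub measurableSet_Iic, ← cdf_eq_real, cdf_quantile_of_continuous hα hc,
    smul_eq_mul, mul_inv_cancel₀]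
  linarith [hα.2]

end Law

/-! ### Deviation probabilities of the indices. -/

section Indices

variable {Ω : Type*} {mΩ : MeasurableSpace Ω} {P : Measure Ω} {ℱ : Filtration ℕ mΩ} {K : ℕ}
  {ν : Fin K → Measure ℝ} {X : Fin K → ℕ → Ω → ℝ} {I : ℕ → Ω → Fin K} {M α m δ : ℝ}

theorem ArmAssumption.m_pos (hν : ArmAssumption ν M α m) (k : Fin K) : 0 < m :=
  (inv_pos.2 (hν.density_pos k)).trans_le (hν.density_inv_le k)

theorem ArmAssumption.M_pos (hν : ArmAssumption ν M α m) (k : Fin K) : 0 < M := by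
  have := hν.prob k
  exact pos_of_bounded_of_continuous (hν.bounded k) (hν.continuous_cdf k)

theorem ae_cost_mem_Icc (hν : ArmAssumption ν M α m) (hX : IsCostProcess P ℱ ν X) :
    ∀ᵐ ω ∂P, ∀ k t, 1 ≤ t → X k t ω ∈ Set.Icc 0 M := by
  rw [ae_all_iff]
  intro k
  rw [ae_all_iff]
  intro t
  by_cases ht : 1 ≤ t
  · have h := hν.bounded k
    rw [← hX.law k t ht] at h
    have := ae_of_ae_map ((hX.adapted k t ht).mono (ℱ.le t) le_rfl).aemeasurable h
    filter_upwards [this] with ω hω _ using hω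
  · exact Filter.Eventually.of_forall fun ω h => absurd h ht

theorem log_confidence {n : ℕ} (hn : 1 ≤ n) (hK : 1 ≤ K) (hδ : δ ∈ Set.Ioo (0 : ℝ) 1) :
    Real.log (2 * (n : ℝ) ^ 2 * K / δ) = Real.log (2 * K / δ) + 2 * Real.log n := by
  have h1 : (n : ℝ) ≠ 0 := by positivity
  have h2 : (K : ℝ) ≠ 0 := by positivity
  rw [show 2 * (n : ℝ) ^ 2 * K / δ = (2 * K / δ) * (n : ℝ) ^ 2 by ring,
    Real.log_mul (by have := hδ.1; positivity) (by positivity), Real.log_pow]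
  norm_num

theorem log_two_mul_div_pos (hK : 1 ≤ K) (hδ : δ ∈ Set.Ioo (0 : ℝ) 1) :
    0 < Real.log (2 * K / δ) := by
  refine Real.log_pos ?_
  rw [lt_div_iff₀ hδ.1]
  have : (1 : ℝ) ≤ K := by exact_mod_cast hK
  linarith [hδ.2]

/-- With high probability the index of an arm does not exceed its CVaR. -/
theorem exists_measureReal_cvar_lt_index_le (K : ℕ) (M α m δ : ℝ) (hα : α ∈ Set.Ioo (0 : ℝ) 1)
    (hδ : δ ∈ Set.Ioo (0 : ℝ) 1) :
    ∃ D : ℝ, 0 ≤ D ∧ ∀ (Ω : Type*) (mΩ : MeasurableSpace Ω) (P : Measure Ω)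
      (_ : IsProbabilityMeasure P) (ℱ : Filtration ℕ mΩ) (ν : Fin K → Measure ℝ)
      (X : Fin K → ℕ → Ω → ℝ) (I : ℕ → Ω → Fin K), ArmAssumption ν M α m →
      IsCostProcess P ℱ ν X → (∀ t, Measurable[ℱ t] (I (t + 1))) → ∀ (k : Fin K) (t : ℕ), 1 ≤ t →
      P.real {ω | 1 ≤ (pullTimes (fun s => I s ω) k t).card ∧ cvar (ν k) α
        < indexCVaR M α m δ (fun s => I s ω) (fun j s => X j s ω) k t} ≤ D / t := by
  -- The shrinking factor `b = 1 - 3δ/t` loses at most `6 (δ/t) L` in the exponent `b² L`, and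
  -- `(δ/t) L ≤ log (2K/δ) + 2`.
  refine ⟨Real.exp (6 * Real.log (2 * K / δ) + 12), (Real.exp_pos _).le, ?_⟩
  intro Ω mΩ P _ ℱ ν X I hν hX hI k t ht
  have hK : 1 ≤ K := Nat.one_le_iff_ne_zero.2 fun h => by subst h; exact k.elim0
  have := hν.prob k
  have hM := hν.M_pos k
  have hm := hν.m_pos k
  have hc : 0 < (1 - α)⁻¹ := inv_pos.2 (by linarith [hα.2])
  have hlK := log_two_mul_div_pos hK hδ
  have ht0 : (0 : ℝ) < t := by exact_mod_cast ht
  -- For `t < 3` the factor `b` may be negative, but the claimed bound exceeds one.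
  rcases lt_or_ge t 3 with ht3 | ht3
  · refine measureReal_le_one.trans ?_
    rw [le_div_iff₀ ht0, one_mul]
    have h1 : (t : ℝ) < 3 := by exact_mod_cast ht3
    have h2 := Real.add_one_le_exp (6 * Real.log (2 * K / δ) + 12)
    linarith
  have ht3' : (3 : ℝ) ≤ t := by exact_mod_cast ht3
  set c := (1 - α)⁻¹ with hcdef
  set q := quantile (cdf (ν k)) α with hqdef
  set L := Real.log (2 * (t : ℝ) ^ 2 * K / δ) with hL
  have hLe : L = Real.log (2 * K / δ) + 2 * Real.log t := log_confidence ht hK hδ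
  have hlt : 0 ≤ Real.log t := Real.log_nonneg (by linarith)
  have hL0 : 0 ≤ L := by rw [hLe]; positivity
  set b := 1 - 3 * δ / t with hb
  have hδt : 3 * δ / t ≤ 1 := by rw [div_le_one ht0]; linarith [hδ.2]
  have hb0 : 0 ≤ b := by linarith
  have hbound := hν.bounded k
  have hid := integrable_id_of_bounded hbound
  have hq := quantile_cdf_mem_Icc hbound hα
  set g : ℝ → ℝ := fun x => max (x - q) 0 with hg
  have hgm : Measurable g := (measurable_id.sub_const q).max measurable_const
  have hgb : ∀ᵐ x ∂(ν k), g x ∈ Set.Icc 0 M := by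
    filter_upwards [hbound] with x hx
    exact ⟨le_max_right _ _, max_le (by linarith [hx.2, hq.1]) hM.le⟩
  have hcv : cvar (ν k) α = q + c * ∫ x, g x ∂(ν k) := by
    rw [← cvarObjective_quantile _ hid hα, cvarObjective]
  -- The number of pulls is random, so a union over its values `T ≤ t` is taken. Each value has
  -- probability of order `t⁻²`, leaving order `t⁻¹`.
  have hsub : {ω | 1 ≤ (pullTimes (fun s => I s ω) k t).card ∧ cvar (ν k) α
        < indexCVaR M α m δ (fun s => I s ω) (fun j s => X j s ω) k t}
      ⊆ ⋃ T ∈ Finset.Icc 1 t, {ω | (pullTimes (fun s => I s ω) k t).card = T ∧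
        (b * M * Real.sqrt (L / (2 * T))) * T ≤ ∑ s ∈ pullTimes (fun s => I s ω) k t,
          (g (X k s ω) - ∫ z, g z ∂(ν k))} := by
    rintro ω ⟨h1, h2⟩
    simp only [Set.mem_iUnion, Set.mem_ofPred_eq]
    refine ⟨_, Finset.mem_Icc.2 ⟨h1, card_pullTimes_le _ _ _⟩, rfl, ?_⟩
    by_contra! h3
    refine absurd h2 (not_lt.2 ?_)
    set S := pullTimes (fun s => I s ω) k t
    have hS : (0 : ℝ) < S.card := by exact_mod_cast h1
    have h4 := empCVaR_le (Finset.card_pos.1 h1) (fun s => X k s ω) hα q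
    rw [Finset.sum_sub_distrib, Finset.sum_const, nsmul_eq_mul] at h3
    have h5 : (S.card : ℝ)⁻¹ * ∑ s ∈ S, g (X k s ω)
        ≤ ∫ z, g z ∂(ν k) + b * M * Real.sqrt (L / (2 * S.card)) := by
      rw [inv_mul_le_iff₀ hS]
      linarith
    have h6 := mul_le_mul_of_nonneg_left h5 hc.le
    have h7 : 0 ≤ 2 * (1 + c) * m * Real.sqrt (L / (2 * S.card)) := by positivity
    unfold indexCVaR epsCVaR
    rw [hcv]
    change empCVaR α S (fun s => X k s ω)
      - (c * b * M + 2 * (1 + c) * m) * Real.sqrt (L / (2 * S.card)) ≤ _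
    change _ ≤ q + c * ((S.card : ℝ)⁻¹ * ∑ s ∈ S, g (X k s ω)) at h4
    linarith
  have hexp : Real.exp (-(b ^ 2 * L))
      ≤ Real.exp (6 * Real.log (2 * K / δ) + 12) / (t : ℝ) ^ 2 := by
    rw [← Real.exp_log (show 0 < (t : ℝ) ^ 2 by positivity), ← Real.exp_sub, Real.log_pow]
    refine Real.exp_le_exp.2 ?_
    have h1 : δ / t * L ≤ Real.log (2 * K / δ) + 2 := by
      rw [hLe, div_mul_eq_mul_div, div_le_iff₀ ht0]
      have h2 : Real.log t ≤ t := Real.log_le_self ht0.le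
      have h3 : δ * (Real.log (2 * K / δ) + 2 * Real.log t)
          ≤ 1 * (Real.log (2 * K / δ) + 2 * Real.log t) := by
        gcongr
        exact hδ.2.le
      nlinarith
    have h2 : b ^ 2 * L = L - 6 * (δ / t * L) + (3 * δ / t) ^ 2 * L := by rw [hb]; ring
    have h3 : 0 ≤ (3 * δ / t) ^ 2 * L := by positivity
    push_cast
    linarith
  calc _ ≤ P.real _ := measureReal_mono hsub (measure_ne_top _ _)
    _ ≤ ∑ T ∈ Finset.Icc 1 t, _ := measureReal_biUnion_finset_le _ _
    _ ≤ ∑ T ∈ Finset.Icc 1 t, Real.exp (6 * Real.log (2 * K / δ) + 12) / (t : ℝ) ^ 2 := by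
        refine Finset.sum_le_sum fun T hT => ?_
        have hT0 : (0 : ℝ) < T := by exact_mod_cast (Finset.mem_Icc.1 hT).1
        refine (measureReal_sum_pullTimes_ge_le hX hI k hgm hM hgb (by positivity) t T).trans ?_
        refine le_trans (le_of_eq ?_) hexp
        congr 2
        rw [sub_zero, show b * M * Real.sqrt (L / (2 * T)) / M = b * Real.sqrt (L / (2 * T)) by
          field_simp, mul_pow, Real.sq_sqrt (by positivity)]
        field_simp
    _ = _ := by
        rw [Finset.sum_const, Nat.card_Icc, nsmul_eq_mul]
        simp only [Nat.add_sub_cancel]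
        field_simp

/-- With high probability the index of an arm pulled often exceeds any value below its CVaR. -/
theorem exists_measureReal_index_le_le (K : ℕ) (M α m δ Δ : ℝ) (hα : α ∈ Set.Ioo (0 : ℝ) 1)
    (hδ : δ ∈ Set.Ioo (0 : ℝ) 1) (hM : 0 < M) (hm : 0 < m) (hΔ : 0 < Δ) :
    ∃ B : ℝ, 0 < B ∧ ∀ (Ω : Type*) (mΩ : MeasurableSpace Ω) (P : Measure Ω)
      (_ : IsProbabilityMeasure P) (ℱ : Filtration ℕ mΩ) (ν : Fin K → Measure ℝ)
      (X : Fin K → ℕ → Ω → ℝ) (I : ℕ → Ω → Fin K), ArmAssumption ν M α m →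
      IsCostProcess P ℱ ν X → (∀ t, Measurable[ℱ t] (I (t + 1))) → ∀ (k : Fin K) (t n : ℕ),
      1 ≤ t → t ≤ n →
      P.real {ω | B * Real.log (2 * (n : ℝ) ^ 2 * K / δ) ≤ (pullTimes (fun s => I s ω) k t).card ∧
        indexCVaR M α m δ (fun s => I s ω) (fun j s => X j s ω) k t ≤ cvar (ν k) α - Δ}
        ≤ 3 / n := by
  have hc : 0 < (1 - α)⁻¹ := inv_pos.2 (by linarith [hα.2])
  set c := (1 - α)⁻¹ with hcdef
  set A := c * M + 2 * (1 + c) * m with hA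
  have hA0 : 0 < A := by positivity
  -- The common Hoeffding rate of the three deviations below: by `Δ / (4c)` for a variable of range
  -- `M`, and by `Δ / (4M)`, on either side, for one of range `c`.
  set κ := 2 * (Δ / (4 * c * M)) ^ 2 with hκ
  have hκ0 : 0 < κ := by positivity
  -- The first summand makes each deviation probability at most `n⁻²`; the second makes the
  -- confidence term at most `Δ / 2`.
  refine ⟨κ⁻¹ + 2 * A ^ 2 / Δ ^ 2, by positivity, ?_⟩
  set B := κ⁻¹ + 2 * A ^ 2 / Δ ^ 2 with hB
  have hB0 : 0 < B := by positivity
  intro Ω mΩ P _ ℱ ν X I hν hX hI k t n ht htn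
  have hK : 1 ≤ K := Nat.one_le_iff_ne_zero.2 fun h => by subst h; exact k.elim0
  have := hν.prob k
  have hlK := log_two_mul_div_pos hK hδ
  have ht0 : (1 : ℝ) ≤ t := by exact_mod_cast ht
  have htn' : (t : ℝ) ≤ n := by exact_mod_cast htn
  have hn0 : (0 : ℝ) < n := by linarith
  set L := Real.log (2 * (n : ℝ) ^ 2 * K / δ) with hL
  have hLe : L = Real.log (2 * K / δ) + 2 * Real.log n := log_confidence (ht.trans htn) hK hδ
  have hLt : Real.log (2 * (t : ℝ) ^ 2 * K / δ) ≤ L := by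
    rw [hLe, log_confidence ht hK hδ]
    have := Real.log_le_log (by linarith) htn'
    linarith
  have hlt : 0 ≤ Real.log n := Real.log_nonneg (by linarith)
  have hL0 : 0 < L := by rw [hLe]; positivity
  have hbound := hν.bounded k
  have hcont := hν.continuous_cdf k
  have hid := integrable_id_of_bounded hbound
  have hq := quantile_cdf_mem_Icc hbound hα
  set q := quantile (cdf (ν k)) α with hqdef
  set g : ℝ → ℝ := fun x => max (x - q) 0 with hg
  set w : ℝ → ℝ := (Set.Ioi q).indicator (fun _ => c) with hw
  have hgm : Measurable g := (measurable_id.sub_const q).max measurable_const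
  have hwm : Measurable w := measurable_const.indicator measurableSet_Ioi
  have hgb : ∀ᵐ x ∂(ν k), -g x ∈ Set.Icc (-M) 0 := by
    filter_upwards [hbound] with x hx
    refine ⟨neg_le_neg (max_le (by linarith [hx.2, hq.1]) hM.le), ?_⟩
    simp [hg]
  have hwb : ∀ x, w x ∈ Set.Icc 0 c := fun x =>
    ⟨Set.indicator_nonneg (fun _ _ => hc.le) x, Set.indicator_le_self' (fun _ _ => hc.le) x⟩
  have hw1 : ∫ x, w x ∂(ν k) = 1 := integral_indicator_Ioi_quantile hα hcont
  have hcv : cvar (ν k) α = q + c * ∫ x, g x ∂(ν k) := by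
    rw [← cvarObjective_quantile _ hid hα, cvarObjective]
  let E (f : ℝ → ℝ) (a : ℝ) (T : ℕ) : Set Ω :=
    {ω | (pullTimes (fun s => I s ω) k t).card = T ∧
      a * T ≤ ∑ s ∈ pullTimes (fun s => I s ω) k t, (f (X k s ω) - ∫ z, f z ∂(ν k))}
  let N : Set Ω := {ω | ¬ ∀ k t, 1 ≤ t → X k t ω ∈ Set.Icc 0 M}
  have hN : P.real N = 0 := by
    rw [measureReal_eq_zero_iff]
    exact ae_cost_mem_Icc hν hX
  let Ts := (Finset.Icc 1 t).filter fun T : ℕ => B * L ≤ T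
  -- Error budget: less than `Δ/4` from the mean excess, less than `Δ/4` from the slope term, at
  -- most `Δ/2` from the confidence term. The null set `N` is removed because `le_empCVaR` needs
  -- costs in `[0, M]`.
  have hsub : {ω | B * L ≤ (pullTimes (fun s => I s ω) k t).card ∧
        indexCVaR M α m δ (fun s => I s ω) (fun j s => X j s ω) k t ≤ cvar (ν k) α - Δ}
      ⊆ N ∪ ⋃ T ∈ Ts, (E (fun x => -g x) (Δ / (4 * c)) T ∪ E w (Δ / (4 * M)) T
        ∪ E (fun x => -w x) (Δ / (4 * M)) T) := by
    rintro ω ⟨h1, h2⟩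
    by_cases hω : ω ∈ N
    · exact Or.inl hω
    refine Or.inr ?_
    simp only [N, Set.mem_ofPred_eq, not_not] at hω
    have hS : (0 : ℝ) < (pullTimes (fun s => I s ω) k t).card := (by positivity : 0 < B * L).trans_le h1
    have hS1 : 0 < (pullTimes (fun s => I s ω) k t).card := by exact_mod_cast hS
    simp only [Set.mem_iUnion]
    refine ⟨_, Finset.mem_filter.2 ⟨Finset.mem_Icc.2 ⟨hS1, card_pullTimes_le _ _ _⟩, h1⟩, ?_⟩
    by_contra h3
    simp only [Set.mem_union, not_or, E, Set.mem_ofPred_eq, true_and, not_le, integral_neg, hw1,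
      Finset.sum_sub_distrib, Finset.sum_const, nsmul_eq_mul, Finset.sum_neg_distrib] at h3
    obtain ⟨⟨h3, h4⟩, h5⟩ := h3
    refine absurd h2 (not_le.2 ?_)
    have hX01 : ∀ s ∈ pullTimes (fun s => I s ω) k t, X k s ω ∈ Set.Icc 0 M := fun s hs =>
      hω k s (Finset.mem_Icc.1 (Finset.mem_filter.1 hs).1).1
    have h6 := le_empCVaR (Finset.card_pos.1 hS1) hα hX01 hq
    set S := pullTimes (fun s => I s ω) k t
    change q + c * ((S.card : ℝ)⁻¹ * ∑ s ∈ S, g (X k s ω))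
      - M * |1 - (S.card : ℝ)⁻¹ * ∑ s ∈ S, w (X k s ω)| ≤ _ at h6
    have h7 : ∫ z, g z ∂(ν k) - Δ / (4 * c) < (S.card : ℝ)⁻¹ * ∑ s ∈ S, g (X k s ω) := by
      rw [lt_inv_mul_iff₀ hS]
      linarith
    have h8 : |1 - (S.card : ℝ)⁻¹ * ∑ s ∈ S, w (X k s ω)| < Δ / (4 * M) := by
      rw [abs_sub_lt_iff, sub_lt_comm, lt_inv_mul_iff₀ hS, sub_lt_iff_lt_add, inv_mul_lt_iff₀ hS]
      constructor <;> linarith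
    have h9 := mul_lt_mul_of_pos_left h7 hc
    have h10 := mul_lt_mul_of_pos_left h8 hM
    rw [mul_sub, show c * (Δ / (4 * c)) = Δ / 4 by field_simp] at h9
    rw [show M * (Δ / (4 * M)) = Δ / 4 by field_simp] at h10
    have h11 : epsCVaR M α m δ K t S.card ≤ Δ / 2 := by
      have hδt : 0 ≤ 3 * δ / t := div_nonneg (by linarith [hδ.1]) (by linarith)
      calc epsCVaR M α m δ K t S.card
          ≤ A * Real.sqrt (Δ ^ 2 / (4 * A ^ 2)) := by
            unfold epsCVaR
            rw [← hcdef]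
            refine mul_le_mul ?_ (Real.sqrt_le_sqrt ?_) (Real.sqrt_nonneg _) hA0.le
            · rw [hA]
              have : c * (1 - 3 * δ / t) * M ≤ c * 1 * M := by
                gcongr
                linarith
              linarith
            · rw [div_le_div_iff₀ (by positivity) (by positivity)]
              have h12 : 2 * A ^ 2 / Δ ^ 2 * L ≤ S.card := by
                refine le_trans ?_ h1
                have : 0 ≤ κ⁻¹ * L := by positivity
                rw [hB, add_mul]
                linarith
              rw [div_mul_eq_mul_div, div_le_iff₀ (by positivity)] at h12
              have h13 := mul_le_mul_of_nonneg_right hLt (show 0 ≤ 4 * A ^ 2 by positivity)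
              linarith
        _ = Δ / 2 := by
            rw [show Δ ^ 2 / (4 * A ^ 2) = (Δ / (2 * A)) ^ 2 by ring,
              Real.sqrt_sq (by positivity)]
            field_simp
    unfold indexCVaR
    rw [hcv]
    change _ < empCVaR α S (fun s => X k s ω) - epsCVaR M α m δ K t S.card
    linarith
  have hexp : ∀ T ∈ Ts, Real.exp (-(κ * T)) ≤ ((n : ℝ) ^ 2)⁻¹ := by
    intro T hT
    have hT := (Finset.mem_filter.1 hT).2
    rw [← Real.exp_log (show 0 < (n : ℝ) ^ 2 by positivity), ← Real.exp_neg, Real.log_pow]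
    refine Real.exp_le_exp.2 (neg_le_neg ?_)
    have h1 : κ⁻¹ * L ≤ T := by
      refine le_trans ?_ hT
      rw [hB, add_mul]
      have : 0 ≤ 2 * A ^ 2 / Δ ^ 2 * L := by positivity
      linarith
    rw [inv_mul_le_iff₀ hκ0] at h1
    push_cast
    linarith
  have hE : ∀ T ∈ Ts, P.real (E (fun x => -g x) (Δ / (4 * c)) T ∪ E w (Δ / (4 * M)) T
        ∪ E (fun x => -w x) (Δ / (4 * M)) T) ≤ 3 * ((n : ℝ) ^ 2)⁻¹ := by
    intro T hT
    have e1 : P.real (E (fun x => -g x) (Δ / (4 * c)) T) ≤ ((n : ℝ) ^ 2)⁻¹ := by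
      refine (measureReal_sum_pullTimes_ge_le hX hI k hgm.neg (by linarith) hgb
        (by positivity) t T).trans (le_trans (le_of_eq ?_) (hexp T hT))
      rw [hκ, show Δ / (4 * c) / (0 - -M) = Δ / (4 * c * M) by
        rw [sub_neg_eq_add, zero_add, div_div]]
      ring_nf
    have e2 : P.real (E w (Δ / (4 * M)) T) ≤ ((n : ℝ) ^ 2)⁻¹ := by
      refine (measureReal_sum_pullTimes_ge_le hX hI k hwm hc (Filter.Eventually.of_forall hwb)
        (by positivity) t T).trans (le_trans (le_of_eq ?_) (hexp T hT))
      rw [hκ, show Δ / (4 * M) / (c - 0) = Δ / (4 * c * M) by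
        rw [sub_zero, div_div, mul_right_comm]]
      ring_nf
    have e3 : P.real (E (fun x => -w x) (Δ / (4 * M)) T) ≤ ((n : ℝ) ^ 2)⁻¹ := by
      refine (measureReal_sum_pullTimes_ge_le hX hI k hwm.neg (l := -c) (u := 0) (by linarith)
        (Filter.Eventually.of_forall fun x =>
          ⟨neg_le_neg (hwb x).2, neg_nonpos.2 (hwb x).1⟩)
        (by positivity) t T).trans (le_trans (le_of_eq ?_) (hexp T hT))
      rw [hκ, show Δ / (4 * M) / (0 - -c) = Δ / (4 * c * M) by
        rw [sub_neg_eq_add, zero_add, div_div, mul_right_comm]]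
      ring_nf
    have e4 := measureReal_union_le (μ := P) (E (fun x => -g x) (Δ / (4 * c)) T ∪ E w (Δ / (4 * M)) T)
      (E (fun x => -w x) (Δ / (4 * M)) T)
    have e5 := measureReal_union_le (μ := P) (E (fun x => -g x) (Δ / (4 * c)) T)
      (E w (Δ / (4 * M)) T)
    linarith
  calc _ ≤ P.real _ := measureReal_mono hsub (measure_ne_top _ _)
    _ ≤ P.real N + _ := measureReal_union_le _ _
    _ ≤ 0 + ∑ T ∈ Ts, _ := add_le_add hN.le (measureReal_biUnion_finset_le _ _)
    _ ≤ 0 + ∑ T ∈ Ts, 3 * ((n : ℝ) ^ 2)⁻¹ := by gcongr with T hT; exact hE T hT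
    _ ≤ n * (3 * ((n : ℝ) ^ 2)⁻¹) := by
        rw [zero_add, Finset.sum_const, nsmul_eq_mul]
        gcongr
        have : Ts.card ≤ t := by simpa using Finset.card_filter_le (Finset.Icc 1 t) fun T : ℕ => B * L ≤ T
        exact this.trans htn
    _ = 3 / n := by field_simp

end Indices

/-! ### Expected number of suboptimal pulls. -/

/-- Every such pull raises the count, so at most `l` occur. The induction needs the sharper bound by
`min l (count)`. -/
theorem card_filter_pull_lt_le {K : ℕ} (i : ℕ → Fin K) (k : Fin K) (l n : ℕ) :
    ((Finset.range n).filter fun t => i (t + 1) = k ∧ (pullTimes i k t).card < l).card ≤ l := by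
  suffices h : ((Finset.range n).filter fun t => i (t + 1) = k ∧ (pullTimes i k t).card < l).card
      ≤ min l (pullTimes i k n).card from h.trans (min_le_left _ _)
  induction n with
  | zero => simp
  | succ n ih =>
    rw [Finset.range_add_one, Finset.filter_insert, pullTimes_succ]
    by_cases h : i (n + 1) = k
    · rw [if_pos h, Finset.card_insert_of_notMem (notMem_pullTimes_succ i k n)]
      split_ifs with h1
      · rw [Finset.card_insert_of_notMem (by simp)]
        omega
      · omega
    · rw [if_neg h, if_neg (by simp [h])]
      exact ih

section PullCount

variable {Ω : Type*} {mΩ : MeasurableSpace Ω} {P : Measure Ω} {ℱ : Filtration ℕ mΩ} {K : ℕ}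
  {ν : Fin K → Measure ℝ} {X : Fin K → ℕ → Ω → ℝ} {I : ℕ → Ω → Fin K} {M α m δ : ℝ}

theorem sum_measureReal_pull_lt_le [IsProbabilityMeasure P] (hX : IsCostProcess P ℱ ν X)
    (hI : ∀ t, Measurable[ℱ t] (I (t + 1))) (k : Fin K) {b : ℝ} (hb : 0 ≤ b) (n : ℕ) :
    ∑ t ∈ Finset.range n,
      P.real {ω | I (t + 1) ω = k ∧ ((pullTimes (fun s => I s ω) k t).card : ℝ) < b} ≤ b + 1 := by
  have hm : ∀ t, MeasurableSet
      {ω | I (t + 1) ω = k ∧ ((pullTimes (fun s => I s ω) k t).card : ℝ) < b} := by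
    intro t
    have h1 := (measurable_sum_pullTimes hX hI k (ξ := fun _ => 1) measurable_const t).mono
      (ℱ.le t) le_rfl
    simp only [Finset.sum_const, nsmul_eq_mul, mul_one] at h1
    exact (ℱ.le t _ (measurableSet_pull hI k t)).inter (measurableSet_lt h1 measurable_const)
  simp_rw [← integral_indicator_one (hm _)]
  have hi : ∀ t ∈ Finset.range n, Integrable (Set.indicator
      {ω | I (t + 1) ω = k ∧ ((pullTimes (fun s => I s ω) k t).card : ℝ) < b} (1 : Ω → ℝ)) P :=
    fun t _ => (integrable_const (1 : ℝ)).indicator (hm t)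
  rw [← integral_finsetSum _ hi]
  have hle : ∀ ω, ∑ t ∈ Finset.range n, Set.indicator
      {ω | I (t + 1) ω = k ∧ ((pullTimes (fun s => I s ω) k t).card : ℝ) < b}
      (1 : Ω → ℝ) ω ≤ b + 1 := by
    intro ω
    have h1 := card_filter_pull_lt_le (fun s => I s ω) k ⌈b⌉₊ n
    rw [Finset.card_filter] at h1
    have h2 : (∑ t ∈ Finset.range n, (if I (t + 1) ω = k ∧
        (pullTimes (fun s => I s ω) k t).card < ⌈b⌉₊ then 1 else 0 : ℝ)) ≤ (⌈b⌉₊ : ℝ) := by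
      exact_mod_cast h1
    refine le_trans (le_of_eq ?_) (h2.trans (Nat.ceil_lt_add_one hb).le)
    refine Finset.sum_congr rfl fun t _ => ?_
    simp only [Set.indicator_apply, Set.mem_ofPred_eq, Pi.one_apply, Nat.lt_ceil]
  refine (integral_mono_of_nonneg (Filter.Eventually.of_forall fun ω =>
    Finset.sum_nonneg fun t _ => Set.indicator_nonneg (fun _ _ => zero_le_one) _)
    (integrable_const (b + 1)) (Filter.Eventually.of_forall hle)).trans ?_
  simp

theorem IsRALCB.one_le_card_pullTimes (hR : IsRALCB ℱ M α m δ X I) (ω : Ω) (k : Fin K) {t : ℕ}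
    (ht : K ≤ t) : 1 ≤ (pullTimes (fun s => I s ω) k t).card := by
  obtain ⟨s, ⟨hs, hk⟩, -⟩ := hR.init ω k
  refine Finset.card_pos.2 ⟨s, Finset.mem_filter.2 ⟨?_, hk⟩⟩
  simp only [Finset.mem_Icc] at hs ⊢
  omega

/-- A harmonic sum; the term `t = 0` is zero by the convention for division by zero. -/
theorem sum_range_div_le_log {D : ℝ} (hD : 0 ≤ D) {n : ℕ} (hn : 1 ≤ n) :
    ∑ t ∈ Finset.range n, D / (t : ℝ) ≤ D * (1 + Real.log n) := by
  obtain ⟨n, rfl⟩ : ∃ n', n = n' + 1 := ⟨n - 1, by omega⟩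
  rw [Finset.sum_range_succ']
  rw [Nat.cast_zero, div_zero, add_zero]
  simp only [div_eq_mul_inv]
  rw [← Finset.mul_sum]
  refine mul_le_mul_of_nonneg_left ?_ hD
  have h1 := harmonic_le_one_add_log n
  have h2 : ((harmonic n : ℚ) : ℝ) = ∑ i ∈ Finset.range n, ((i + 1 : ℕ) : ℝ)⁻¹ := by
    simp [harmonic]
  rw [h2] at h1
  refine h1.trans ?_
  rcases Nat.eq_zero_or_pos n with rfl | h
  · simp
  · have : Real.log n ≤ Real.log ((n + 1 : ℕ) : ℝ) :=
      Real.log_le_log (by exact_mod_cast h) (by push_cast; linarith)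
    linarith

/-- Logarithmic bound for the expected number of pulls of a suboptimal arm. -/
theorem exists_sum_measureReal_pull_le (K : ℕ) (M α m δ Δ : ℝ) (hα : α ∈ Set.Ioo (0 : ℝ) 1)
    (hδ : δ ∈ Set.Ioo (0 : ℝ) 1) (hM : 0 < M) (hm : 0 < m) (hΔ : 0 < Δ) :
    ∃ D : ℝ, 0 ≤ D ∧ ∀ (Ω : Type*) (mΩ : MeasurableSpace Ω) (P : Measure Ω)
      (_ : IsProbabilityMeasure P) (ℱ : Filtration ℕ mΩ) (ν : Fin K → Measure ℝ)
      (X : Fin K → ℕ → Ω → ℝ) (I : ℕ → Ω → Fin K), ArmAssumption ν M α m →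
      IsCostProcess P ℱ ν X → IsRALCB ℱ M α m δ X I → ∀ k kstar : Fin K,
      cvar (ν k) α - cvar (ν kstar) α = Δ → ∀ n : ℕ, K < n →
      ∑ t ∈ Finset.range n, P.real {ω | I (t + 1) ω = k} ≤ D * Real.log n := by
  obtain ⟨D, hD0, hD⟩ := exists_measureReal_cvar_lt_index_le K M α m δ hα hδ
  obtain ⟨B, hB0, hB⟩ := exists_measureReal_index_le_le K M α m δ Δ hα hδ hM hm hΔ
  rcases Nat.eq_zero_or_pos K with rfl | hK
  · exact ⟨0, le_rfl, fun _ _ _ _ _ _ _ _ _ _ _ k => k.elim0⟩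
  have hlK := log_two_mul_div_pos hK hδ
  have hl2 : 0 < Real.log 2 := Real.log_pos (by norm_num)
  -- Additive constants are absorbed into `log n` through `log n ≥ log 2`, as `n > K ≥ 1`.
  refine ⟨(B * Real.log (2 * K / δ) + 4 + K + D) / Real.log 2 + (2 * B + D), by positivity, ?_⟩
  intro Ω mΩ P _ ℱ ν X I hν hX hR k kstar hk n hn
  have hn1 : 1 ≤ n := by omega
  have hn2 : (2 : ℝ) ≤ n := by exact_mod_cast (by omega : 2 ≤ n)
  set L := Real.log (2 * (n : ℝ) ^ 2 * K / δ) with hL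
  have hLe : L = Real.log (2 * K / δ) + 2 * Real.log n := log_confidence hn1 hK hδ
  have hlog : Real.log 2 ≤ Real.log n := Real.log_le_log (by norm_num) hn2
  have hL0 : 0 ≤ L := by rw [hLe]; linarith
  -- The four terms cover few earlier pulls, the initial round, an index of the best arm above its
  -- CVaR, and an index of arm `k` too low by the gap. Their sums over `t < n` are `O(log n)`, at
  -- most `K`, `O(log n)` and `3`.
  have hstep : ∀ t ∈ Finset.range n, P.real {ω | I (t + 1) ω = k}
      ≤ P.real {ω | I (t + 1) ω = k ∧ ((pullTimes (fun s => I s ω) k t).card : ℝ) < B * L}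
        + (if t < K then 1 else 0) + D / t + 3 / n := by
    intro t ht
    have htn : t ≤ n := (Finset.mem_range.1 ht).le
    by_cases htK : t < K
    · rw [if_pos htK]
      have h1 := measureReal_le_one (μ := P) (s := {ω | I (t + 1) ω = k})
      have h2 := measureReal_nonneg (μ := P)
        (s := {ω | I (t + 1) ω = k ∧ ((pullTimes (fun s => I s ω) k t).card : ℝ) < B * L})
      have h3 : 0 ≤ D / t := by positivity
      have h4 : (0 : ℝ) ≤ 3 / n := by positivity
      linarith
    · rw [if_neg htK, add_zero]
      have ht1 : 1 ≤ t := by omega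
      have b1 := hD Ω mΩ P inferInstance ℱ ν X I hν hX hR.predictable kstar t ht1
      have b2 := hB Ω mΩ P inferInstance ℱ ν X I hν hX hR.predictable k t n ht1 htn
      set E1 := {ω | 1 ≤ (pullTimes (fun s => I s ω) kstar t).card ∧ cvar (ν kstar) α
        < indexCVaR M α m δ (fun s => I s ω) (fun j s => X j s ω) kstar t}
      set E2 := {ω | B * L ≤ (pullTimes (fun s => I s ω) k t).card ∧
        indexCVaR M α m δ (fun s => I s ω) (fun j s => X j s ω) k t ≤ cvar (ν k) α - Δ}
      set E3 := {ω | I (t + 1) ω = k ∧ ((pullTimes (fun s => I s ω) k t).card : ℝ) < B * L}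
      have hsub : {ω | I (t + 1) ω = k} ⊆ E3 ∪ E1 ∪ E2 := by
        intro ω hω
        by_contra h
        simp only [Set.mem_union, not_or, E1, E2, E3, Set.mem_ofPred_eq, not_and, not_lt,
          not_le] at h hω
        obtain ⟨⟨h3, h1⟩, h2⟩ := h
        have h1 := h1 (hR.one_le_card_pullTimes ω kstar (by omega))
        have h2 := h2 (h3 hω)
        have h4 := hR.argmin ω t (by omega) kstar
        rw [hω] at h4
        linarith
      have u1 := measureReal_mono (μ := P) hsub
      have u2 := measureReal_union_le (μ := P) (E3 ∪ E1) E2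
      have u3 := measureReal_union_le (μ := P) E3 E1
      linarith
  have hBL : 0 ≤ B * L := by positivity
  have s1 := sum_measureReal_pull_lt_le hX hR.predictable k hBL n
  have s2 : ∑ t ∈ Finset.range n, (if t < K then 1 else 0 : ℝ) ≤ K := by
    rw [Finset.sum_boole]
    have : ((Finset.range n).filter fun t => t < K) ⊆ Finset.range K := by
      intro t ht
      simpa using (Finset.mem_filter.1 ht).2
    exact_mod_cast (Finset.card_le_card this).trans (Finset.card_range K).le
  have s3 := sum_range_div_le_log hD0 hn1
  have s4 : ∑ _t ∈ Finset.range n, (3 : ℝ) / n = 3 := by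
    rw [Finset.sum_const, Finset.card_range, nsmul_eq_mul]
    field_simp
  have hsum := Finset.sum_le_sum hstep
  simp only [Finset.sum_add_distrib] at hsum
  have hfin : B * Real.log (2 * K / δ) + 4 + K + D
      ≤ (B * Real.log (2 * K / δ) + 4 + K + D) / Real.log 2 * Real.log n := by
    rw [div_mul_eq_mul_div, le_div_iff₀ hl2]
    gcongr
  rw [hLe] at s1
  rw [add_mul, hLe] at *
  linarith

end PullCount

/-! ### From pull counts to regret. -/

section Regret

variable {Ω : Type*} {mΩ : MeasurableSpace Ω} {P : Measure Ω} {ℱ : Filtration ℕ mΩ} {K : ℕ}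
  {ν : Fin K → Measure ℝ} {X : Fin K → ℕ → Ω → ℝ} {I : ℕ → Ω → Fin K} {M α m δ : ℝ}

theorem measurable_choice (hI : ∀ t, Measurable[ℱ t] (I (t + 1))) {t : ℕ} (ht : 1 ≤ t) :
    Measurable (I t) := by
  obtain ⟨s, rfl⟩ : ∃ s, t = s + 1 := ⟨t - 1, by omega⟩
  exact (hI s).mono (ℱ.le s) le_rfl

theorem measurable_cost (hX : IsCostProcess P ℱ ν X) (k : Fin K) {t : ℕ} (ht : 1 ≤ t) :
    Measurable (X k t) :=
  (hX.adapted k t ht).mono (ℱ.le t) le_rfl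

theorem measurable_observation (hX : IsCostProcess P ℱ ν X)
    (hI : ∀ t, Measurable[ℱ t] (I (t + 1))) {t : ℕ} (ht : 1 ≤ t) :
    Measurable fun ω => X (I t ω) t ω := by
  have h : Measurable fun p : Fin K × Ω => X p.1 t p.2 :=
    measurable_from_prod_countable_right fun k => measurable_cost hX k ht
  exact h.comp ((measurable_choice hI ht).prodMk measurable_id)

theorem ae_policyCVaR_mem_Icc (hα : α ∈ Set.Ioo (0 : ℝ) 1) (hν : ArmAssumption ν M α m)
    (hX : IsCostProcess P ℱ ν X) {n : ℕ} (hn : 1 ≤ n) :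
    ∀ᵐ ω ∂P, policyCVaR α X I n ω ∈ Set.Icc 0 ((1 - α)⁻¹ * M) := by
  filter_upwards [ae_cost_mem_Icc hν hX] with ω hω
  exact empCVaR_mem_Icc (Finset.nonempty_Icc.2 hn) hα fun t ht =>
    hω _ _ (Finset.mem_Icc.1 ht).1

theorem integrable_policyCVaR [IsProbabilityMeasure P] (hα : α ∈ Set.Ioo (0 : ℝ) 1)
    (hν : ArmAssumption ν M α m) (hX : IsCostProcess P ℱ ν X)
    (hI : ∀ t, Measurable[ℱ t] (I (t + 1))) {n : ℕ} (hn : 1 ≤ n) :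
    Integrable (policyCVaR α X I n) P := by
  refine Integrable.of_mem_Icc 0 ((1 - α)⁻¹ * M) (Measurable.aemeasurable ?_)
    (ae_policyCVaR_mem_Icc hα hν hX hn)
  exact measurable_empCVaR (Finset.nonempty_Icc.2 hn) hα fun t ht =>
    measurable_observation hX hI (Finset.mem_Icc.1 ht).1

theorem cvar_nonneg (hα : α ∈ Set.Ioo (0 : ℝ) 1) (hν : ArmAssumption ν M α m) (k : Fin K) :
    0 ≤ cvar (ν k) α := by
  have := hν.prob k
  rw [← cvarObjective_quantile _ (integrable_id_of_bounded (hν.bounded k)) hα, cvarObjective]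
  have h1 := (quantile_cdf_mem_Icc (hν.bounded k) hα).1
  have h2 : 0 ≤ ∫ x, max (x - quantile (cdf (ν k)) α) 0 ∂(ν k) :=
    integral_nonneg fun _ => le_max_right _ _
  have h3 : 0 ≤ (1 - α)⁻¹ := inv_nonneg.2 (by linarith [hα.2])
  positivity

theorem pseudoRegret_le_range [IsProbabilityMeasure P] (hα : α ∈ Set.Ioo (0 : ℝ) 1)
    (hν : ArmAssumption ν M α m) (hX : IsCostProcess P ℱ ν X)
    (hI : ∀ t, Measurable[ℱ t] (I (t + 1))) (kstar : Fin K) {n : ℕ} (hn : 1 ≤ n) :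
    pseudoRegret P α ν kstar X I n ≤ (1 - α)⁻¹ * M := by
  have h1 := integral_mono_ae (integrable_policyCVaR hα hν hX hI hn)
    (integrable_const ((1 - α)⁻¹ * M))
    ((ae_policyCVaR_mem_Icc (I := I) hα hν hX hn).mono fun ω hω => hω.2)
  have h2 := cvar_nonneg hα hν kstar
  simp only [integral_const, probReal_univ, smul_eq_mul, one_mul] at h1
  unfold pseudoRegret
  linarith

/-- The pseudo regret is controlled by the expected number of pulls of suboptimal arms. -/
theorem pseudoRegret_le_sum [IsProbabilityMeasure P] (hα : α ∈ Set.Ioo (0 : ℝ) 1)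
    (hν : ArmAssumption ν M α m) (hX : IsCostProcess P ℱ ν X)
    (hI : ∀ t, Measurable[ℱ t] (I (t + 1))) (kstar : Fin K) {n : ℕ} (hn : 1 ≤ n) :
    pseudoRegret P α ν kstar X I n ≤ (1 - α)⁻¹ * ((n : ℝ)⁻¹ *
      ∑ t ∈ Finset.range n, M * P.real {ω | I (t + 1) ω ≠ kstar}) := by
  have := hν.prob kstar
  have hM := hν.M_pos kstar
  have hc : 0 < (1 - α)⁻¹ := inv_pos.2 (by linarith [hα.2])
  have hn0 : (0 : ℝ) < n := by exact_mod_cast hn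
  have hbound := hν.bounded kstar
  have hid := integrable_id_of_bounded hbound
  have hq := quantile_cdf_mem_Icc hbound hα
  have hcv := cvarObjective_quantile _ hid hα
  unfold cvarObjective at hcv
  set q := quantile (cdf (ν kstar)) α with hqdef
  set h := ∫ x, max (x - q) 0 ∂(ν kstar) with hh
  have hA : ∀ t, MeasurableSet {ω | I (t + 1) ω ≠ kstar} := fun t =>
    (ℱ.le t _ (measurableSet_pull hI kstar t)).compl
  let U (t : ℕ) (ω : Ω) : ℝ := {ω | I (t + 1) ω ≠ kstar}.indicator (fun _ => M) ω
  let V (t : ℕ) (ω : Ω) : ℝ := max (X kstar (t + 1) ω - q) 0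
  have hU : ∀ t, Integrable (U t) P := fun t => (integrable_const M).indicator (hA t)
  have hVm : ∀ t, Measurable (X kstar (t + 1)) := fun t => measurable_cost hX kstar (by omega)
  have hgm : Measurable fun x : ℝ => max (x - q) 0 :=
    (measurable_id.sub_const q).max measurable_const
  have hV : ∀ t, Integrable (V t) P := by
    intro t
    have h1 := integrable_posPart_sub hid q
    rw [← hX.law kstar (t + 1) (by omega)] at h1
    exact h1.comp_measurable (hVm t)
  have hVi : ∀ t, ∫ ω, V t ω ∂P = h := by
    intro t
    rw [hh, ← hX.law kstar (t + 1) (by omega),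
      integral_map (hVm t).aemeasurable hgm.aestronglyMeasurable]
  have hUi : ∀ t, ∫ ω, U t ω ∂P = M * P.real {ω | I (t + 1) ω ≠ kstar} := by
    intro t
    rw [integral_indicator_const _ (hA t), smul_eq_mul, mul_comm]
  -- `V` is the excess of the best arm's cost whether or not that arm is pulled, so its mean is
  -- untouched by the policy; `U` pays `M` at every other pull.
  have hle : ∀ᵐ ω ∂P, policyCVaR α X I n ω
      ≤ q + (1 - α)⁻¹ * ((n : ℝ)⁻¹ * ∑ t ∈ Finset.range n, (U t ω + V t ω)) := by
    filter_upwards [ae_cost_mem_Icc hν hX] with ω hω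
    have h1 := empCVaR_le (Finset.nonempty_Icc.2 hn) (fun t => X (I t ω) t ω) hα q
    unfold policyCVaR
    refine h1.trans ?_
    have hI1 : Finset.Icc 1 n = (Finset.range n).image (· + 1) := by
      ext t
      simp only [Finset.mem_Icc, Finset.mem_image, Finset.mem_range]
      exact ⟨fun ht => ⟨t - 1, by omega, by omega⟩, by rintro ⟨s, hs, rfl⟩; omega⟩
    rw [Nat.card_Icc, Nat.add_sub_cancel, hI1,
      Finset.sum_image fun a _ b _ hab => Nat.succ_injective hab]
    gcongr with t ht
    by_cases hk : I (t + 1) ω = kstar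
    · simp [U, V, hk]
    · have h2 : U t ω = M := Set.indicator_of_mem (by exact hk) _
      have h3 : 0 ≤ V t ω := le_max_right _ _
      have h4 := (hω (I (t + 1) ω) (t + 1) (by omega)).2
      rw [h2]
      exact max_le (by linarith [hq.1]) (by linarith)
  have hint : Integrable (fun ω => ∑ t ∈ Finset.range n, (U t ω + V t ω)) P :=
    integrable_finsetSum _ fun t _ => (hU t).add (hV t)
  have h5 := integral_mono_ae (integrable_policyCVaR hα hν hX hI hn)
    ((integrable_const q).add ((hint.const_mul _).const_mul _)) hle
  simp only [Pi.add_apply] at h5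
  rw [integral_add (integrable_const q) ((hint.const_mul _).const_mul _), integral_const_mul,
    integral_const_mul, integral_finsetSum _ fun t _ => (by exact (hU t).add (hV t))] at h5
  simp only [integral_const, probReal_univ, smul_eq_mul, one_mul] at h5
  have h6 : ∀ t, ∫ ω, (U t ω + V t ω) ∂P = M * P.real {ω | I (t + 1) ω ≠ kstar} + h := by
    intro t
    rw [integral_add (hU t) (hV t), hUi, hVi]
  simp only [h6, Finset.sum_add_distrib, Finset.sum_const, Finset.card_range, nsmul_eq_mul] at h5
  rw [mul_add, inv_mul_cancel_left₀ hn0.ne'] at h5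
  unfold pseudoRegret
  linarith

/-- The pseudo regret is of order `log n / n`. -/
theorem exists_pseudoRegret_le_log (K : ℕ) (M α m δ : ℝ) (hα : α ∈ Set.Ioo (0 : ℝ) 1)
    (hδ : δ ∈ Set.Ioo (0 : ℝ) 1) (hM : 0 < M) (hm : 0 < m) (Δ : Fin K → ℝ) :
    ∃ D : ℝ, 0 ≤ D ∧ ∀ (Ω : Type*) (mΩ : MeasurableSpace Ω) (P : Measure Ω)
      (_ : IsProbabilityMeasure P) (ℱ : Filtration ℕ mΩ) (ν : Fin K → Measure ℝ)
      (X : Fin K → ℕ → Ω → ℝ) (I : ℕ → Ω → Fin K), ArmAssumption ν M α m →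
      IsCostProcess P ℱ ν X → IsRALCB ℱ M α m δ X I → ∀ kstar : Fin K,
      (∀ k, k ≠ kstar → 0 < Δ k) → (∀ k, Δ k = cvar (ν k) α - cvar (ν kstar) α) →
      ∀ n : ℕ, K < n → pseudoRegret P α ν kstar X I n ≤ D * (Real.log n / n) := by
  have hc : 0 < (1 - α)⁻¹ := inv_pos.2 (by linarith [hα.2])
  -- The constants must be chosen from the gaps before the laws and `kstar` are known; an arm whose
  -- given gap is not positive receives the constant zero.
  have hex : ∀ k, ∃ D : ℝ, 0 ≤ D ∧ (0 < Δ k → ∀ (Ω : Type _) (mΩ : MeasurableSpace Ω)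
      (P : Measure Ω) (_ : IsProbabilityMeasure P) (ℱ : Filtration ℕ mΩ) (ν : Fin K → Measure ℝ)
      (X : Fin K → ℕ → Ω → ℝ) (I : ℕ → Ω → Fin K), ArmAssumption ν M α m →
      IsCostProcess P ℱ ν X → IsRALCB ℱ M α m δ X I → ∀ k' kstar : Fin K,
      cvar (ν k') α - cvar (ν kstar) α = Δ k → ∀ n : ℕ, K < n →
      ∑ t ∈ Finset.range n, P.real {ω | I (t + 1) ω = k'} ≤ D * Real.log n) := by
    intro k
    by_cases h : 0 < Δ k
    · obtain ⟨D, h0, hD⟩ := exists_sum_measureReal_pull_le K M α m δ (Δ k) hα hδ hM hm h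
      exact ⟨D, h0, fun _ => hD⟩
    · exact ⟨0, le_rfl, fun h' => absurd h' h⟩
  choose D hD0 hD using hex
  refine ⟨(1 - α)⁻¹ * (M * ∑ k, D k), mul_nonneg hc.le (mul_nonneg hM.le
    (Finset.sum_nonneg fun k _ => hD0 k)), ?_⟩
  intro Ω mΩ P _ ℱ ν X I hν hX hR kstar hpos hΔ n hn
  have hn1 : 1 ≤ n := by omega
  have hln : 0 ≤ Real.log n := Real.log_nonneg (by exact_mod_cast hn1)
  refine (pseudoRegret_le_sum hα hν hX hR.predictable kstar hn1).trans ?_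
  have h1 : ∑ t ∈ Finset.range n, P.real {ω | I (t + 1) ω ≠ kstar} ≤ (∑ k, D k) * Real.log n := by
    calc ∑ t ∈ Finset.range n, P.real {ω | I (t + 1) ω ≠ kstar}
        ≤ ∑ t ∈ Finset.range n, ∑ k ∈ Finset.univ.filter (fun k => k ≠ kstar),
            P.real {ω | I (t + 1) ω = k} := by
          refine Finset.sum_le_sum fun t _ => ?_
          refine le_trans (measureReal_mono ?_ (measure_ne_top _ _))
            (measureReal_biUnion_finset_le _ _)
          intro ω hω
          simp only [Set.mem_iUnion]
          exact ⟨I (t + 1) ω, Finset.mem_filter.2 ⟨Finset.mem_univ _, hω⟩, rfl⟩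
      _ = ∑ k ∈ Finset.univ.filter (fun k => k ≠ kstar), ∑ t ∈ Finset.range n,
            P.real {ω | I (t + 1) ω = k} := Finset.sum_comm
      _ ≤ ∑ k ∈ Finset.univ.filter (fun k => k ≠ kstar), D k * Real.log n := by
          refine Finset.sum_le_sum fun k hk => ?_
          exact hD k (hpos k (Finset.mem_filter.1 hk).2) Ω mΩ P inferInstance ℱ ν X I hν hX hR
            k kstar (hΔ k).symm n hn
      _ ≤ ∑ k, D k * Real.log n := Finset.sum_le_sum_of_subset_of_nonneg (Finset.filter_subset _ _)
          fun k _ _ => mul_nonneg (hD0 k) hln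
      _ = _ := by rw [Finset.sum_mul]
  rw [← Finset.mul_sum]
  calc _ ≤ (1 - α)⁻¹ * ((n : ℝ)⁻¹ * (M * ((∑ k, D k) * Real.log n))) := by gcongr
    _ = _ := by ring

end Regret

/-! ### Asymptotic order of the bound. -/

section Asymptotics

open Filter Topology

theorem tendsto_log_div_nat : Tendsto (fun n : ℕ => Real.log n / n) atTop (𝓝 0) := by
  have := (Real.isLittleO_log_id_atTop.tendsto_div_nhds_zero).comp tendsto_natCast_atTop_atTop
  exact this

theorem tendsto_sqrt_log_div : Tendsto (fun n : ℕ => Real.sqrt (Real.log n / n)) atTop (𝓝 0) := by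
  have h := (Real.continuous_sqrt.tendsto 0).comp tendsto_log_div_nat
  rwa [Real.sqrt_zero] at h

theorem log_div_isLittleO_sqrt :
    (fun n : ℕ => Real.log n / n) =o[atTop] fun n : ℕ => Real.sqrt (Real.log n / n) := by
  have h : (fun n : ℕ => Real.sqrt (Real.log n / n) * Real.sqrt (Real.log n / n))
      =o[atTop] fun n : ℕ => 1 * Real.sqrt (Real.log n / n) :=
    ((isLittleO_one_iff ℝ).2 tendsto_sqrt_log_div).mul_isBigO (isBigO_refl _ _)
  refine h.congr (fun n => ?_) (fun n => one_mul _)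
  exact Real.mul_self_sqrt (div_nonneg (Real.log_natCast_nonneg n) n.cast_nonneg)

theorem const_isBigO_log (a : ℝ) :
    (fun _ : ℕ => a) =O[atTop] fun n : ℕ => Real.log n := by
  refine ((isLittleO_const_left.2 (Or.inr ?_))).isBigO
  exact tendsto_norm_atTop_atTop.comp (Real.tendsto_log_atTop.comp tendsto_natCast_atTop_atTop)

theorem inv_isLittleO_sqrt :
    (fun n : ℕ => (n : ℝ)⁻¹) =o[atTop] fun n : ℕ => Real.sqrt (Real.log n / n) := by
  refine IsBigO.trans_isLittleO ?_ log_div_isLittleO_sqrt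
  have := (const_isBigO_log 1).mul (isBigO_refl (fun n : ℕ => (n : ℝ)⁻¹) atTop)
  simpa [div_eq_mul_inv] using this

variable {C α m δ : ℝ}

theorem Mphi_isBigO (C α m : ℝ) {δ : ℝ} (hδ : δ ∈ Set.Ioo (0 : ℝ) 1) :
    (fun n : ℕ => Mphi C α m δ n) =O[atTop] fun n : ℕ => Real.sqrt (Real.log n / n) := by
  have hl2 : 0 < Real.log 2 := Real.log_pos (by norm_num)
  have hl4 : 0 < Real.log (4 / δ) := Real.log_pos (by rw [lt_div_iff₀ hδ.1]; linarith [hδ.2])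
  have h1 : (fun n : ℕ => max α (1 - α) * (C * (Real.log n / n)) * m)
      =O[atTop] fun n : ℕ => Real.sqrt (Real.log n / n) := by
    have := (log_div_isLittleO_sqrt.isBigO.const_mul_left (max α (1 - α) * C * m))
    refine this.congr_left fun n => ?_
    ring
  have h2 : (fun n : ℕ => Real.sqrt (Real.log (4 * n / δ) / (2 * n)))
      =O[atTop] fun n : ℕ => Real.sqrt (Real.log n / n) := by
    refine IsBigO.of_bound (Real.sqrt (Real.log (4 / δ) / Real.log 2 + 1)) ?_
    filter_upwards [eventually_ge_atTop 2] with n hn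
    have hn2 : (2 : ℝ) ≤ n := by exact_mod_cast hn
    have hlog : Real.log 2 ≤ Real.log n := Real.log_le_log (by norm_num) hn2
    rw [Real.norm_of_nonneg (Real.sqrt_nonneg _), Real.norm_of_nonneg (Real.sqrt_nonneg _),
      ← Real.sqrt_mul (by positivity)]
    refine Real.sqrt_le_sqrt ?_
    rw [mul_div_right_comm, Real.log_mul (by have := hδ.1; positivity) (by positivity),
      ← mul_div_assoc, add_mul]
    have h3 : Real.log (4 / δ) ≤ Real.log (4 / δ) / Real.log 2 * Real.log n := by
      rw [div_mul_eq_mul_div, le_div_iff₀ hl2]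
      gcongr
    rw [div_le_div_iff₀ (by positivity) (by positivity)]
    have h4 : Real.log (4 / δ) + Real.log n
        ≤ Real.log (4 / δ) / Real.log 2 * Real.log n + 1 * Real.log n := by linarith
    refine mul_le_mul h4 (by linarith) (by positivity) (by positivity)
  exact h1.add (h2.const_mul_left _)

theorem sqrt_isBigO_Mphi (hC : 0 ≤ C) (hα : α ∈ Set.Ioo (0 : ℝ) 1) (hm : 0 < m)
    (hδ : δ ∈ Set.Ioo (0 : ℝ) 1) :
    (fun n : ℕ => Real.sqrt (Real.log n / n)) =O[atTop] fun n : ℕ => Mphi C α m δ n := by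
  refine IsBigO.of_bound (Real.sqrt 2 / (2 * m)) ?_
  filter_upwards [eventually_ge_atTop 1] with n hn
  have hn1 : (1 : ℝ) ≤ n := by exact_mod_cast hn
  have hln := Real.log_natCast_nonneg n
  have hmax : 0 ≤ max α (1 - α) := hα.1.le.trans (le_max_left _ _)
  have h1 : Real.log n ≤ Real.log (4 * n / δ) := by
    refine Real.log_le_log (by linarith) ?_
    rw [le_div_iff₀ hδ.1]
    nlinarith [hδ.1, hδ.2]
  have h2 : 0 ≤ max α (1 - α) * (C * (Real.log n / n)) * m := by positivity
  have h3 : 2 * m * Real.sqrt (Real.log (4 * n / δ) / (2 * n)) ≤ Mphi C α m δ n := by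
    unfold Mphi
    linarith
  have h4 : Real.sqrt (Real.log n / n)
      ≤ Real.sqrt 2 * Real.sqrt (Real.log (4 * n / δ) / (2 * n)) := by
    rw [← Real.sqrt_mul (by norm_num)]
    refine Real.sqrt_le_sqrt ?_
    rw [show 2 * (Real.log (4 * n / δ) / (2 * n)) = Real.log (4 * n / δ) / n by field_simp]
    gcongr
  rw [Real.norm_of_nonneg (Real.sqrt_nonneg _)]
  calc _ ≤ _ := h4
    _ = Real.sqrt 2 / (2 * m) * (2 * m * Real.sqrt (Real.log (4 * n / δ) / (2 * n))) := by
        field_simp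
    _ ≤ _ := by
        gcongr
        exact h3.trans (le_abs_self _)

theorem Mk_isBigO_log {K : ℕ} (hK : 1 ≤ K) (M α m : ℝ) {δ Δ : ℝ} (hδ : δ ∈ Set.Ioo (0 : ℝ) 1)
    (hΔ : Δ ≠ 0) :
    (fun n : ℕ => Mk M α m δ K Δ n) =O[atTop] fun n : ℕ => Real.log n := by
  have h1 : (fun n : ℕ => Real.log (2 * (n : ℝ) ^ 2 * K / δ)) =O[atTop]
      fun n : ℕ => Real.log n := by
    refine ((const_isBigO_log (Real.log (2 * K / δ))).add
      ((isBigO_refl (fun n : ℕ => Real.log n) atTop).const_mul_left 2)).congr' ?_ EventuallyEq.rfl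
    filter_upwards [eventually_ge_atTop 1] with n hn
    exact (log_confidence hn hK hδ).symm
  have h2 : Tendsto (fun n : ℕ => Δ - (1 - α)⁻¹ * (4 * δ / ((n : ℝ) ^ 2 * K)) * M) atTop
      (𝓝 (Δ - (1 - α)⁻¹ * 0 * M)) := by
    refine tendsto_const_nhds.sub ((Tendsto.const_mul _ ?_).mul_const _)
    refine tendsto_const_nhds.div_atTop ?_
    refine Tendsto.atTop_mul_const (by exact_mod_cast hK) ?_
    exact (tendsto_pow_atTop two_ne_zero).comp tendsto_natCast_atTop_atTop
  rw [mul_zero, zero_mul, sub_zero] at h2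
  have h3 : (fun n : ℕ => ((2 * (1 + (1 - α)⁻¹) * m + (1 - α)⁻¹ * M)
      / (Δ - (1 - α)⁻¹ * (4 * δ / ((n : ℝ) ^ 2 * K)) * M)) ^ 2) =O[atTop] fun _ => (1 : ℝ) :=
    ((tendsto_const_nhds.div h2 hΔ).pow 2).isBigO_one ℝ
  have h4 := (h1.const_mul_left 2).mul h3
  simp only [mul_one] at h4
  exact h4.add (const_isBigO_log _)

/-- Besides `Mphi` there are only terms of order `log n / n`, of order `1 / n`, and `(4δ/n) Mphi`.
All are `o(√(log n / n))`, while `Mphi` is at least of that order. -/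
theorem regretBound_isEquivalent {K : ℕ} (hC : 0 ≤ C) (M : ℝ) (hα : α ∈ Set.Ioo (0 : ℝ) 1)
    (hm : 0 < m) (hδ : δ ∈ Set.Ioo (0 : ℝ) 1) (kstar : Fin K) {Δ : Fin K → ℝ}
    (hΔ : ∀ k, k ≠ kstar → 0 < Δ k) (j : Fin K) :
    IsEquivalent atTop (fun n : ℕ => regretBound C M α m δ kstar Δ j n)
      (fun n : ℕ => Mphi C α m δ n) := by
  have hK : 1 ≤ K := Nat.one_le_iff_ne_zero.2 fun h => by subst h; exact j.elim0
  refine IsLittleO.trans_isBigO ?_ (sqrt_isBigO_Mphi hC hα hm hδ)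
  have hinv : Tendsto (fun n : ℕ => 4 * δ / n) atTop (𝓝 0) :=
    tendsto_const_nhds.div_atTop tendsto_natCast_atTop_atTop
  have hφ1 := (Mphi_isBigO C α m hδ)
  have t1 : (fun n : ℕ => 4 * δ / n * Mphi C α m δ n) =o[atTop]
      fun n : ℕ => Real.sqrt (Real.log n / n) := by
    have := ((isLittleO_one_iff ℝ).2 hinv).mul_isBigO hφ1
    simpa only [one_mul] using this
  have t2 : (fun n : ℕ => 4 * δ / n * (((1 - α)⁻¹ + 1) * M + (1 - α)⁻¹ * Δ j)) =o[atTop]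
      fun n : ℕ => Real.sqrt (Real.log n / n) := by
    refine (inv_isLittleO_sqrt.const_mul_left
      (4 * δ * (((1 - α)⁻¹ + 1) * M + (1 - α)⁻¹ * Δ j))).congr_left fun n => ?_
    ring
  have t3 : (fun n : ℕ => ∑ k ∈ Finset.univ.filter (fun k => k ≠ kstar),
      Mk M α m δ K (Δ k) n * (M + Δ k)) =O[atTop] fun n : ℕ => Real.log n := by
    refine IsBigO.fun_sum fun k hk => ?_
    have := (Mk_isBigO_log hK M α m hδ (hΔ k (Finset.mem_filter.1 hk).2).ne').const_mul_left
      (M + Δ k)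
    exact this.congr_left fun n => mul_comm _ _
  have t4 : (fun n : ℕ => (1 - 4 * δ / n) * ((1 - α)⁻¹ * (1 / n)
      * ∑ k ∈ Finset.univ.filter (fun k => k ≠ kstar), Mk M α m δ K (Δ k) n * (M + Δ k)))
      =o[atTop] fun n : ℕ => Real.sqrt (Real.log n / n) := by
    refine IsBigO.trans_isLittleO ?_ log_div_isLittleO_sqrt
    have h1 : (fun n : ℕ => (1 - 4 * δ / n)) =O[atTop] fun _ => (1 : ℝ) :=
      (tendsto_const_nhds.sub hinv).isBigO_one ℝ
    have h2 := (t3.mul (isBigO_refl (fun n : ℕ => (n : ℝ)⁻¹) atTop)).const_mul_left (1 - α)⁻¹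
    refine (h1.mul h2).congr (fun n => ?_) (fun n => ?_)
    · ring
    · rw [one_mul, div_eq_mul_inv]
  refine ((t4.add t2).sub t1).congr_left fun n => ?_
  simp only [regretBound, Pi.sub_apply]
  ring

end Asymptotics

/-! ### Absorbing the regret into the stated bound. -/

/-- Since `n` is an integer, `n > 4δ` forces `n ≥ ⌊4δ⌋ + 1`, where `1 - 4δ/n` is already positive.
-/
theorem exists_pos_le_one_sub_div (δ : ℝ) (hδ : 0 < δ) :
    ∃ c : ℝ, 0 < c ∧ ∀ n : ℕ, 4 * δ < n → c ≤ 1 - 4 * δ / n := by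
  have h := Nat.lt_floor_add_one (4 * δ)
  have h0 : (0 : ℝ) < (⌊4 * δ⌋₊ : ℝ) + 1 := by positivity
  refine ⟨1 - 4 * δ / (⌊4 * δ⌋₊ + 1), by rw [sub_pos, div_lt_one h0]; exact h, fun n hn => ?_⟩
  have h1 : ⌊4 * δ⌋₊ + 1 ≤ n := (Nat.floor_lt (by positivity)).2 hn
  have h2 : (⌊4 * δ⌋₊ : ℝ) + 1 ≤ n := by exact_mod_cast h1
  gcongr

theorem le_regretBound {K : ℕ} {C M α m δ D c : ℝ} (hα : α ∈ Set.Ioo (0 : ℝ) 1)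
    (hδ : δ ∈ Set.Ioo (0 : ℝ) 1) (hM : 0 < M) (hm : 0 < m) (hc : 0 < c) (hD : 0 ≤ D)
    (hc1 : ∀ n : ℕ, 4 * δ < n → c ≤ 1 - 4 * δ / n)
    (hC : C = D / (c * max α (1 - α) * m)) (kstar j : Fin K) {Δ : Fin K → ℝ}
    (hΔ : ∀ k, 0 ≤ Δ k) {n : ℕ} (hn : K < n) (hδn : 4 * δ ≤ n) {R : ℝ}
    (hR1 : R ≤ (1 - α)⁻¹ * M) (hR2 : R ≤ D * (Real.log n / n)) :
    R ≤ regretBound C M α m δ kstar Δ j n := by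
  have hK : 1 ≤ K := Nat.one_le_iff_ne_zero.2 fun h => by subst h; exact j.elim0
  have hn0 : (1 : ℝ) ≤ n := by exact_mod_cast (by omega : 1 ≤ n)
  have ha : 0 < (1 - α)⁻¹ := inv_pos.2 (by linarith [hα.2])
  have hmax : 0 < max α (1 - α) := lt_max_of_lt_left hα.1
  have hln := Real.log_natCast_nonneg n
  have hδ0 := hδ.1
  have hC0 : 0 ≤ C := by rw [hC]; positivity
  have hlast : (1 - α)⁻¹ * M ≤ ((1 - α)⁻¹ + 1) * M + (1 - α)⁻¹ * Δ j := by
    have := mul_nonneg ha.le (hΔ j)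
    linarith
  -- If `4δ < n`, the `C`-term alone dominates the logarithmic bound and every other term is
  -- nonnegative. If `4δ = n`, only the last term survives and the range bound is used.
  rcases hδn.lt_or_eq with h | h
  · have h1 := hc1 n h
    have hsum : 0 ≤ ∑ k ∈ Finset.univ.filter (fun k => k ≠ kstar),
        Mk M α m δ K (Δ k) n * (M + Δ k) := by
      refine Finset.sum_nonneg fun k _ => mul_nonneg ?_ (add_nonneg hM.le (hΔ k))
      have hlog : 0 ≤ Real.log (2 * (n : ℝ) ^ 2 * K / δ) := by
        rw [log_confidence (by omega) hK hδ]
        linarith [log_two_mul_div_pos hK hδ]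
      unfold Mk
      positivity
    have hlow : D * (Real.log n / n) ≤ c * (max α (1 - α) * (C * (Real.log n / n)) * m) := by
      rw [hC]
      refine le_of_eq ?_
      field_simp
    have hM1 : max α (1 - α) * (C * (Real.log n / n)) * m ≤ Mphi C α m δ n
        + (1 - α)⁻¹ * (1 / n) * ∑ k ∈ Finset.univ.filter (fun k => k ≠ kstar),
          Mk M α m δ K (Δ k) n * (M + Δ k) := by
      have e1 : 0 ≤ 2 * m * Real.sqrt (Real.log (4 * n / δ) / (2 * n)) := by positivity
      have e2 : 0 ≤ (1 - α)⁻¹ * (1 / n) * ∑ k ∈ Finset.univ.filter (fun k => k ≠ kstar),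
          Mk M α m δ K (Δ k) n * (M + Δ k) := by positivity
      unfold Mphi
      linarith
    have e3 := mul_le_mul h1 hM1 (by positivity) (hc.le.trans h1)
    have e4 : 0 ≤ 4 * δ / n * (((1 - α)⁻¹ + 1) * M + (1 - α)⁻¹ * Δ j) :=
      mul_nonneg (by positivity) (le_trans (by positivity) hlast)
    unfold regretBound
    linarith
  · have h1 : 4 * δ / n = 1 := by rw [h]; exact div_self (by positivity)
    unfold regretBound
    rw [h1, sub_self, zero_mul, zero_add, one_mul]
    linarith

end RiskBandit

theorem theorem1 (K : ℕ) (M α m δ : ℝ) (hα : α ∈ Set.Ioo (0 : ℝ) 1) (hδ : δ ∈ Set.Ioo (0 : ℝ) 1)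
    (Δ : Fin K → ℝ) :
    ∃ C : ℝ, 0 ≤ C ∧
      ∀ (ν : Fin K → Measure ℝ) (_ : RiskBandit.ArmAssumption ν M α m)
        (kstar : Fin K)
        (_ : ∀ k, k ≠ kstar → RiskBandit.cvar (ν kstar) α < RiskBandit.cvar (ν k) α)
        (_ : ∀ k, Δ k = RiskBandit.cvar (ν k) α - RiskBandit.cvar (ν kstar) α),
        (∀ (Ω : Type*) (mΩ : MeasurableSpace Ω) (P : Measure Ω) (_ : IsProbabilityMeasure P)
            (ℱ : Filtration ℕ mΩ) (X : Fin K → ℕ → Ω → ℝ) (I : ℕ → Ω → Fin K)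
            (_ : RiskBandit.IsCostProcess P ℱ ν X)
            (_ : RiskBandit.IsRALCB ℱ M α m δ X I)
            (n : ℕ) (_ : K < n),
            Integrable (RiskBandit.policyCVaR α X I n) P ∧
              (4 * δ ≤ n → ∀ j : Fin K,
                RiskBandit.pseudoRegret P α ν kstar X I n
                  ≤ RiskBandit.regretBound C M α m δ kstar Δ j n)) ∧
        (∀ j : Fin K,
          IsEquivalent Filter.atTop
            (fun n : ℕ => RiskBandit.regretBound C M α m δ kstar Δ j n)
            (fun n : ℕ => RiskBandit.Mphi C α m δ n)) ∧
        (fun n : ℕ => RiskBandit.Mphi C α m δ n)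
          =O[Filter.atTop] (fun n : ℕ => Real.sqrt (Real.log n / n)) ∧
        (∀ j : Fin K,
          (fun n : ℕ => RiskBandit.regretBound C M α m δ kstar Δ j n)
            =O[Filter.atTop] (fun n : ℕ => Real.sqrt (Real.log n / n))) := by
  by_cases h : 0 < M ∧ 0 < m
  swap
  -- The existence of an arm forces `M` and `m` to be positive, so this case is vacuous.
  · refine ⟨0, le_rfl, fun ν hν kstar => absurd ⟨hν.M_pos kstar, hν.m_pos kstar⟩ h⟩
  obtain ⟨hM, hm⟩ := h
  obtain ⟨D, hD0, hD⟩ := RiskBandit.exists_pseudoRegret_le_log K M α m δ hα hδ hM hm Δ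
  obtain ⟨c, hc0, hc⟩ := RiskBandit.exists_pos_le_one_sub_div δ hδ.1
  have hmax : 0 < max α (1 - α) := lt_max_of_lt_left hα.1
  -- Chosen so that `c * max α (1 - α) * C * m = D`, with `c` the lower bound of `1 - 4δ/n`.
  refine ⟨D / (c * max α (1 - α) * m), by positivity, ?_⟩
  intro ν hν kstar hopt hΔ
  have hpos : ∀ k, k ≠ kstar → 0 < Δ k := fun k hk => by
    rw [hΔ]
    exact sub_pos.2 (hopt k hk)
  have hnonneg : ∀ k, 0 ≤ Δ k := fun k => by
    by_cases hk : k = kstar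
    · rw [hΔ, hk, sub_self]
    · exact (hpos k hk).le
  have hequiv := RiskBandit.regretBound_isEquivalent (C := D / (c * max α (1 - α) * m))
    (by positivity) M hα hm hδ kstar hpos
  have hO := RiskBandit.Mphi_isBigO (D / (c * max α (1 - α) * m)) α m hδ
  refine ⟨?_, hequiv, hO, fun j => (hequiv j).isBigO.trans hO⟩
  intro Ω mΩ P hP ℱ X I hX hI n hn
  refine ⟨RiskBandit.integrable_policyCVaR hα hν hX hI.predictable (by omega), fun hδn j => ?_⟩
  exact RiskBandit.le_regretBound hα hδ hM hm hc0 hD0 hc rfl kstar j hnonneg hn hδn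
    (RiskBandit.pseudoRegret_le_range hα hν hX hI.predictable kstar (by omega))
    (hD Ω mΩ P hP ℱ ν X I hν hX hI kstar hpos hΔ n hn)
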